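/- Let $P$ be a set of $n$ points in the interior of an axis-aligned rectangle $R$, no two sharing an $x$- or a $y$-coordinate, each with a color from a finite color set $C$. A \emph{labeling with finite backbones} of $P$ consists of finitely many labels $l$ on the right side of $R$, each with a color $c(l)$ and a height $y(l)$, together with an assignment of each point of $P$ to a label of the same color. The \emph{leader} of a label $l$ is the union of its \emph{backbone}, i.e. the horizontal segment at height $y(l)$ from the $x$-coordinate of the leftmost point assigned to $l$ to the right side of $R$, and of the vertical segments that connect the points assigned to $l$ to this backbone (it is empty if no point is assigned to $l$). The labeling is \emph{crossing-free} if the leaders of distinct labels are disjoint (they neither overlap nor cross); the number of labels is not restricted. There is an algorithm (for the real RAM with unit-cost arithmetic and comparisons on real numbers and on integers of $O(\log(n+|C|))$ bits) that, given $R$, the points of $P$ in any order and their colors (encoded as the integers $0,\dots,|C|-1$), computes a crossing-free labeling of $P$ with finite backbones, i.e. the labels and the assignment, that has the minimum number of labels among all crossing-free labelings of $P$ with finite backbones. Its running time for $n\ge 1$ is $O(n^4|C|^2)$. -/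

import Mathlib

namespace Backbone

/-! ### Backbone labelings with finite backbones -/

/-- An input with `n` points and color set `Fin m`: an axis-aligned rectangle, points inside it
(so that labels can be placed above and below all points), no two of which share an `x`- or
`y`-coordinate, and their colors. The points come in arbitrary order. -/
structure ColoredPoints (n m : ℕ) where
  xmin : ℝ
  xmax : ℝ
  ymin : ℝ
  ymax : ℝ
  pt : Fin n → ℝ × ℝ
  color : Fin n → Fin m
  pt_mem : ∀ i, pt i ∈ Set.Ioo xmin xmax ×ˢ Set.Ioo ymin ymax
  x_injective : Function.Injective fun i => (pt i).1
  y_injective : Function.Injective fun i => (pt i).2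

/-- A collection of `numLabels` colored labels, each given by its color and the `y`-coordinate of
its backbone, together with an assignment of the points to the labels. -/
structure Labeling (n m : ℕ) where
  numLabels : ℕ
  color : Fin numLabels → Fin m
  y : Fin numLabels → ℝ
  assign : Fin n → Fin numLabels

namespace ColoredPoints

variable {n m : ℕ} (I : ColoredPoints n m) (L : Labeling n m)

/-- The finite backbone of label `l`: the horizontal segment at height `y(l)` from the leftmost
point assigned to `l` to the right side of the rectangle (empty if no point is assigned). -/
def backbone (l : Fin L.numLabels) : Set (ℝ × ℝ) :=
  {z | z.2 = L.y l ∧ z.1 ≤ I.xmax ∧ ∃ i, L.assign i = l ∧ (I.pt i).1 ≤ z.1}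

/-- The vertical segment that connects point `i` to the backbone of its label. -/
def connector (i : Fin n) : Set (ℝ × ℝ) :=
  {z | z.1 = (I.pt i).1 ∧ z.2 ∈ Set.uIcc (I.pt i).2 (L.y (L.assign i))}

/-- The backbone leader of label `l`, as a subset of the plane. -/
def leader (l : Fin L.numLabels) : Set (ℝ × ℝ) :=
  I.backbone L l ∪ ⋃ i ∈ {i : Fin n | L.assign i = l}, I.connector L i

/-- Crossing-free feasible labelings (no bound on the number of labels): all labels lie on the
right side of the rectangle, each point is assigned to a label of its own color, and the leaders
of distinct labels neither overlap nor cross, i.e. they are disjoint. -/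
structure IsCrossingFree : Prop where
  y_mem : ∀ l, L.y l ∈ Set.Icc I.ymin I.ymax
  color_eq : ∀ i, L.color (L.assign i) = I.color i
  disjoint : ∀ l l', l ≠ l' → Disjoint (I.leader L l) (I.leader L l')

/-- A crossing-free feasible labeling with the minimum number of labels. -/
def IsOptimal : Prop :=
  I.IsCrossingFree L ∧ ∀ L' : Labeling n m, I.IsCrossingFree L' → L.numLabels ≤ L'.numLabels

end ColoredPoints

/-! ### The real RAM

A random access machine with word-size integers and with real numbers. Integers below the word
bound `W` and reals are kept apart: there are finitely many scalar variables and arrays of either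
sort in a program, indices are integers, and there is no conversion (in particular no rounding)
from reals to integers. Every operation, memory access and test costs one unit of time. -/

/-- The contents of integer variables, integer arrays, real variables and real arrays. -/
structure State where
  ivar : ℕ → ℕ
  imem : ℕ → ℕ → ℕ
  rvar : ℕ → ℝ
  rmem : ℕ → ℕ → ℝ

/-- Integer expressions; `read a i` is the entry of array `a` at index `i`. -/
inductive IExp where
  | const (c : ℕ)
  | var (v : ℕ)
  | read (a : ℕ) (i : IExp)
  | add (e f : IExp)
  | sub (e f : IExp)
  | mul (e f : IExp)
  | div (e f : IExp)
  | mod (e f : IExp)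

namespace IExp

def eval (s : State) : IExp → ℕ
  | const c => c
  | var v => s.ivar v
  | read a i => s.imem a (i.eval s)
  | add e f => e.eval s + f.eval s
  | sub e f => e.eval s - f.eval s
  | mul e f => e.eval s * f.eval s
  | div e f => e.eval s / f.eval s
  | mod e f => e.eval s % f.eval s

/-- The expression can be evaluated on a machine with word bound `W`: no (intermediate) value
overflows and there is no division by zero. -/
def Fits (W : ℕ) (s : State) : IExp → Prop
  | const c => c < W
  | var v => s.ivar v < W
  | read a i => i.Fits W s ∧ s.imem a (i.eval s) < W
  | add e f => e.Fits W s ∧ f.Fits W s ∧ e.eval s + f.eval s < W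
  | sub e f => e.Fits W s ∧ f.Fits W s
  | mul e f => e.Fits W s ∧ f.Fits W s ∧ e.eval s * f.eval s < W
  | div e f => e.Fits W s ∧ f.Fits W s ∧ f.eval s ≠ 0
  | mod e f => e.Fits W s ∧ f.Fits W s ∧ f.eval s ≠ 0

/-- Time to evaluate: one unit for each constant, access and operation. -/
def cost : IExp → ℕ
  | const _ => 1
  | var _ => 1
  | read _ i => i.cost + 1
  | add e f => e.cost + f.cost + 1
  | sub e f => e.cost + f.cost + 1
  | mul e f => e.cost + f.cost + 1
  | div e f => e.cost + f.cost + 1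
  | mod e f => e.cost + f.cost + 1

end IExp

/-- Real expressions. -/
inductive RExp where
  | const (q : ℚ)
  | var (v : ℕ)
  | read (a : ℕ) (i : IExp)
  | add (e f : RExp)
  | sub (e f : RExp)
  | mul (e f : RExp)
  | div (e f : RExp)

namespace RExp

noncomputable def eval (s : State) : RExp → ℝ
  | const q => (q : ℝ)
  | var v => s.rvar v
  | read a i => s.rmem a (i.eval s)
  | add e f => e.eval s + f.eval s
  | sub e f => e.eval s - f.eval s
  | mul e f => e.eval s * f.eval s
  | div e f => e.eval s / f.eval s

def Fits (W : ℕ) (s : State) : RExp → Prop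
  | const _ => True
  | var _ => True
  | read _ i => i.Fits W s
  | add e f => e.Fits W s ∧ f.Fits W s
  | sub e f => e.Fits W s ∧ f.Fits W s
  | mul e f => e.Fits W s ∧ f.Fits W s
  | div e f => e.Fits W s ∧ f.Fits W s ∧ f.eval s ≠ 0

def cost : RExp → ℕ
  | const _ => 1
  | var _ => 1
  | read _ i => i.cost + 1
  | add e f => e.cost + f.cost + 1
  | sub e f => e.cost + f.cost + 1
  | mul e f => e.cost + f.cost + 1
  | div e f => e.cost + f.cost + 1

end RExp

/-- Tests: comparisons of integers and of reals, and their Boolean combinations. -/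
inductive Test where
  | ilt (e f : IExp)
  | ieq (e f : IExp)
  | rlt (e f : RExp)
  | req (e f : RExp)
  | not (b : Test)
  | and (b c : Test)
  | or (b c : Test)

namespace Test

def Holds (s : State) : Test → Prop
  | ilt e f => e.eval s < f.eval s
  | ieq e f => e.eval s = f.eval s
  | rlt e f => e.eval s < f.eval s
  | req e f => e.eval s = f.eval s
  | not b => ¬ b.Holds s
  | and b c => b.Holds s ∧ c.Holds s
  | or b c => b.Holds s ∨ c.Holds s

def Fits (W : ℕ) (s : State) : Test → Prop
  | ilt e f => e.Fits W s ∧ f.Fits W s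
  | ieq e f => e.Fits W s ∧ f.Fits W s
  | rlt e f => e.Fits W s ∧ f.Fits W s
  | req e f => e.Fits W s ∧ f.Fits W s
  | not b => b.Fits W s
  | and b c => b.Fits W s ∧ c.Fits W s
  | or b c => b.Fits W s ∧ c.Fits W s

def cost : Test → ℕ
  | ilt e f => e.cost + f.cost + 1
  | ieq e f => e.cost + f.cost + 1
  | rlt e f => e.cost + f.cost + 1
  | req e f => e.cost + f.cost + 1
  | not b => b.cost + 1
  | and b c => b.cost + c.cost + 1
  | or b c => b.cost + c.cost + 1

end Test

/-- Programs: assignments to variables (`iset`, `rset`) and to array entries (`iwrite`,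
`rwrite`), sequencing, branching and while-loops. -/
inductive Prog where
  | skip
  | iset (v : ℕ) (e : IExp)
  | iwrite (a : ℕ) (i e : IExp)
  | rset (v : ℕ) (e : RExp)
  | rwrite (a : ℕ) (i : IExp) (e : RExp)
  | seq (p q : Prog)
  | ite (b : Test) (p q : Prog)
  | loop (b : Test) (p : Prog)

namespace State

def setI (s : State) (v x : ℕ) : State :=
  { s with ivar := Function.update s.ivar v x }

def writeI (s : State) (a i x : ℕ) : State :=
  { s with imem := Function.update s.imem a (Function.update (s.imem a) i x) }

def setR (s : State) (v : ℕ) (x : ℝ) : State :=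
  { s with rvar := Function.update s.rvar v x }

def writeR (s : State) (a i : ℕ) (x : ℝ) : State :=
  { s with rmem := Function.update s.rmem a (Function.update (s.rmem a) i x) }

end State

/-- `Exec W p s t s'`: on a machine with word bound `W`, program `p` started in state `s` halts
in state `s'` after exactly `t` units of time, without overflow or division by zero. -/
inductive Exec (W : ℕ) : Prog → State → ℕ → State → Prop where
  | skip (s : State) : Exec W .skip s 1 s
  | iset {s : State} {v : ℕ} {e : IExp} (he : e.Fits W s) :
      Exec W (.iset v e) s (e.cost + 1) (s.setI v (e.eval s))
  | iwrite {s : State} {a : ℕ} {i e : IExp} (hi : i.Fits W s) (he : e.Fits W s) :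
      Exec W (.iwrite a i e) s (i.cost + e.cost + 1) (s.writeI a (i.eval s) (e.eval s))
  | rset {s : State} {v : ℕ} {e : RExp} (he : e.Fits W s) :
      Exec W (.rset v e) s (e.cost + 1) (s.setR v (e.eval s))
  | rwrite {s : State} {a : ℕ} {i : IExp} {e : RExp} (hi : i.Fits W s) (he : e.Fits W s) :
      Exec W (.rwrite a i e) s (i.cost + e.cost + 1) (s.writeR a (i.eval s) (e.eval s))
  | seq {s s₁ s₂ : State} {p q : Prog} {t₁ t₂ : ℕ} (hp : Exec W p s t₁ s₁)
      (hq : Exec W q s₁ t₂ s₂) : Exec W (.seq p q) s (t₁ + t₂) s₂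
  | ite_true {s s₁ : State} {b : Test} {p q : Prog} {t : ℕ} (hf : b.Fits W s) (hb : b.Holds s)
      (hp : Exec W p s t s₁) : Exec W (.ite b p q) s (b.cost + t + 1) s₁
  | ite_false {s s₁ : State} {b : Test} {p q : Prog} {t : ℕ} (hf : b.Fits W s)
      (hb : ¬ b.Holds s) (hq : Exec W q s t s₁) : Exec W (.ite b p q) s (b.cost + t + 1) s₁
  | loop_done {s : State} {b : Test} {p : Prog} (hf : b.Fits W s) (hb : ¬ b.Holds s) :
      Exec W (.loop b p) s (b.cost + 1) s
  | loop_step {s s₁ s₂ : State} {b : Test} {p : Prog} {t₁ t₂ : ℕ} (hf : b.Fits W s)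
      (hb : b.Holds s) (hp : Exec W p s t₁ s₁) (hl : Exec W (.loop b p) s₁ t₂ s₂) :
      Exec W (.loop b p) s (b.cost + t₁ + t₂ + 1) s₂

/-- The initial state: integer variables `0, 1` hold `n` and the number `m` of colors, integer
array `0` the colors of the points, real variables `0, 1, 2, 3` the sides of the rectangle, real
arrays `0` and `1` the `x`- and `y`-coordinates of the points; everything else is `0`. -/
noncomputable def inputState {n m : ℕ} (I : ColoredPoints n m) : State where
  ivar v := match v with
    | 0 => n
    | 1 => m
    | _ => 0
  imem a i := match a with
    | 0 => if h : i < n then (I.color ⟨i, h⟩ : ℕ) else 0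
    | _ => 0
  rvar v := match v with
    | 0 => I.xmin
    | 1 => I.xmax
    | 2 => I.ymin
    | 3 => I.ymax
    | _ => 0
  rmem a i := match a with
    | 0 => if h : i < n then (I.pt ⟨i, h⟩).1 else 0
    | 1 => if h : i < n then (I.pt ⟨i, h⟩).2 else 0
    | _ => 0

/-- The state `s` holds the labeling `L` as output: the number of labels in integer variable `0`,
the labels of the points in integer array `1`, the colors and `y`-coordinates of the labels in
integer array `2` and real array `2`. -/
structure Outputs {n m : ℕ} (s : State) (L : Labeling n m) : Prop where
  numLabels : s.ivar 0 = L.numLabels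
  assign : ∀ i : Fin n, s.imem 1 i = L.assign i
  color : ∀ l : Fin L.numLabels, s.imem 2 l = L.color l
  y : ∀ l : Fin L.numLabels, s.rmem 2 l = L.y l

end Backbone

/-!
A finite backbone reaches from its leftmost point to the right side of the rectangle, so the
backbones that meet a vertical line also meet all vertical lines further to the right. Two
consecutive ones therefore bound a strip whose points can be labeled independently of all other
points. The leftmost point of the strip is either connected to a bounding backbone of its color, or
it starts a new backbone of its color, which splits the strip in two. Of a backbone only its color
and the number of points below it matter. This gives a recurrence for the minimum number of
additional backbones with `O(n * (n * m) ^ 2)` entries, each of them a minimum over `O(n)`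
decisions. A sweep from left to right then follows optimal decisions.
-/

namespace Backbone

open scoped Finset

/-! ### The recurrence -/

section Recurrence

/-- The decisions for a point of color `c` between consecutive backbones `b` and `t`, where a
backbone is represented by the number of points below it and its color: `none` connects the point
to one of the two backbones, and `some g` starts a new backbone with `g` points below it. -/
def IsAllowed (c : ℕ) (b t : ℕ × ℕ) : Option ℕ → Prop
  | none => c = b.2 ∨ c = t.2
  | some g => b.1 ≤ g ∧ g ≤ t.1

/-- The number of additional backbones between `b` and `t` caused by a decision, where `F` counts
those needed for the points to the right of the current one. -/
def decisionCost (F : ℕ × ℕ → ℕ × ℕ → ℕ) (c : ℕ) (b t : ℕ × ℕ) : Option ℕ → ℕ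
  | none => F b t
  | some g => F b (g, c) + F (g, c) t + 1

/-- The minimum number of additional backbones for those of the `k` rightmost points that lie
between two backbones `b` and `t`. The point with `k` points to its right has `r k` points below
it and color `c k`. -/
noncomputable def minBackbones (r c : ℕ → ℕ) : ℕ → ℕ × ℕ → ℕ × ℕ → ℕ
  | 0, _, _ => 0
  | k + 1, b, t =>
    if b.1 ≤ r k ∧ r k < t.1 then
      sInf (decisionCost (minBackbones r c k) (c k) b t '' {o | IsAllowed (c k) b t o})
    else minBackbones r c k b t

/-- An allowed decision for point `k` that attains the minimum. -/
structure IsOptimalDecision (r c : ℕ → ℕ) (k : ℕ) (b t : ℕ × ℕ) (o : Option ℕ) : Prop where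
  isAllowed : IsAllowed (c k) b t o
  cost_eq : minBackbones r c (k + 1) b t = decisionCost (minBackbones r c k) (c k) b t o

variable {r c : ℕ → ℕ} {k : ℕ} {b t : ℕ × ℕ} {o : Option ℕ}

theorem minBackbones_succ_of_not (h : ¬ (b.1 ≤ r k ∧ r k < t.1)) :
    minBackbones r c (k + 1) b t = minBackbones r c k b t :=
  if_neg h

theorem minBackbones_succ_le (h : b.1 ≤ r k ∧ r k < t.1) (ho : IsAllowed (c k) b t o) :
    minBackbones r c (k + 1) b t ≤ decisionCost (minBackbones r c k) (c k) b t o := by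
  rw [minBackbones, if_pos h]
  exact Nat.sInf_le ⟨o, ho, rfl⟩

theorem isOptimalDecision_of_forall_le (h : b.1 ≤ r k ∧ r k < t.1)
    (ho : IsAllowed (c k) b t o)
    (hle : ∀ o', IsAllowed (c k) b t o' → decisionCost (minBackbones r c k) (c k) b t o ≤
      decisionCost (minBackbones r c k) (c k) b t o') :
    IsOptimalDecision r c k b t o := by
  refine ⟨ho, (minBackbones_succ_le h ho).antisymm ?_⟩
  rw [minBackbones, if_pos h]
  exact le_csInf ⟨_, o, ho, rfl⟩ (Set.forall_mem_image.2 hle)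

theorem minBackbones_eq_zero (h : t.1 ≤ b.1) : minBackbones r c k b t = 0 := by
  induction k with
  | zero => rfl
  | succ k ih => rw [minBackbones_succ_of_not (by omega), ih]

theorem minBackbones_le : minBackbones r c k b t ≤ k := by
  induction k generalizing b with
  | zero => exact le_rfl
  | succ k ih =>
    by_cases h : b.1 ≤ r k ∧ r k < t.1
    · have hsplit : minBackbones r c (k + 1) b t ≤
          minBackbones r c k b (b.1, c k) + minBackbones r c k (b.1, c k) t + 1 :=
        minBackbones_succ_le (o := some b.1) h ⟨le_rfl, by omega⟩
      rw [minBackbones_eq_zero (t := (b.1, c k)) (le_refl b.1), zero_add] at hsplit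
      exact hsplit.trans (Nat.succ_le_succ ih)
    · exact (minBackbones_succ_of_not h).trans_le (ih.trans k.le_succ)

end Recurrence

/-! ### The points in sorted order -/

section Rank

/-- The number of indices below `n` at which `f` has a smaller value than at `i`. -/
noncomputable def rank (n : ℕ) (f : ℕ → ℝ) (i : ℕ) : ℕ := #{j ∈ Finset.range n | f j < f i}

/-- The index below `n` of a given rank. -/
noncomputable def nth (n : ℕ) (f : ℕ → ℝ) : ℕ → ℕ := Function.invFunOn (rank n f) (Set.Iio n)

variable {n : ℕ} {f : ℕ → ℝ}

theorem rank_lt {i : ℕ} (hi : i < n) : rank n f i < n := by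
  conv_rhs => rw [← Finset.card_range n]
  exact Finset.card_lt_card (Finset.filter_ssubset.2 ⟨i, by simp [hi]⟩)

theorem card_filter_le_le_rank {i : ℕ} {a : ℝ} (h : a < f i) :
    #{j ∈ Finset.range n | f j ≤ a} ≤ rank n f i :=
  Finset.card_le_card (Finset.monotone_filter_right _ fun _ _ hj => hj.trans_lt h)

theorem rank_lt_card_filter_le {i : ℕ} {a : ℝ} (hi : i < n) (h : f i ≤ a) :
    rank n f i < #{j ∈ Finset.range n | f j ≤ a} := by
  refine Finset.card_lt_card (Finset.ssubset_iff_of_subset ?_ |>.2 ⟨i, by simp [hi, h], by simp⟩)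
  exact Finset.monotone_filter_right _ fun _ _ hj => hj.le.trans h

theorem rank_lt_rank {i j : ℕ} (hi : i < n) (h : f i < f j) : rank n f i < rank n f j :=
  (rank_lt_card_filter_le hi le_rfl).trans_le (card_filter_le_le_rank h)

variable (hf : Set.InjOn f (Set.Iio n))

include hf

theorem bijOn_rank : Set.BijOn (rank n f) (Set.Iio n) (Set.Iio n) := by
  have hmaps : Set.MapsTo (rank n f) (Set.Iio n) (Set.Iio n) := fun _ hi => rank_lt hi
  have hinj : Set.InjOn (rank n f) (Set.Iio n) := fun i hi j hj hij => hf hi hj <| by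
    by_contra hne
    rcases lt_or_gt_of_ne hne with h | h
    · exact (rank_lt_rank hi h).ne hij
    · exact (rank_lt_rank hj h).ne' hij
  rw [← Finset.coe_range] at hmaps hinj ⊢
  exact ⟨hmaps, hinj, Finset.surjOn_of_injOn_of_card_le _ hmaps hinj le_rfl⟩

theorem nth_lt {r : ℕ} (hr : r < n) : nth n f r < n :=
  Function.invFunOn_mem ((bijOn_rank hf).surjOn hr)

theorem rank_nth {r : ℕ} (hr : r < n) : rank n f (nth n f r) = r :=
  Function.invFunOn_eq ((bijOn_rank hf).surjOn hr)

theorem nth_rank {i : ℕ} (hi : i < n) : nth n f (rank n f i) = i :=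
  (bijOn_rank hf).injOn.leftInvOn_invFunOn hi

theorem apply_nth_lt_apply_nth {r r' : ℕ} (h : r < r') (hr' : r' < n) :
    f (nth n f r) < f (nth n f r') := by
  have hr := h.trans hr'
  by_contra! hle
  rcases hle.lt_or_eq with hlt | heq
  · have := rank_lt_rank (nth_lt hf hr') hlt
    rw [rank_nth hf hr, rank_nth hf hr'] at this
    exact this.not_gt h
  · have := congrArg (rank n f) (hf (nth_lt hf hr') (nth_lt hf hr) heq)
    rw [rank_nth hf hr, rank_nth hf hr'] at this
    exact h.ne' this

end Rank

namespace ColoredPoints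

variable {n m : ℕ} (I : ColoredPoints n m)

/-- The `x`-coordinate of an input point, extended by `0` like the input arrays of the machine. -/
noncomputable def xAt (i : ℕ) : ℝ := if h : i < n then (I.pt ⟨i, h⟩).1 else 0

/-- The `y`-coordinate of an input point, extended by `0`. -/
noncomputable def yAt (i : ℕ) : ℝ := if h : i < n then (I.pt ⟨i, h⟩).2 else 0

/-- The color of an input point, extended by `0`. -/
def colorAt (i : ℕ) : ℕ := if h : i < n then (I.color ⟨i, h⟩ : ℕ) else 0

/-- The point with `k` points to its right, which is called point `k` in the sequel. -/
noncomputable def order : ℕ → ℕ := nth n fun i => -I.xAt i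

/-- The height of point `k`. -/
noncomputable def sortedY (k : ℕ) : ℝ := I.yAt (I.order k)

/-- The number of points below point `k`. -/
noncomputable def sortedRank (k : ℕ) : ℕ := rank n I.yAt (I.order k)

/-- The color of point `k`. -/
noncomputable def sortedColor (k : ℕ) : ℕ := I.colorAt (I.order k)

/-- The number of points at or below height `h`. -/
noncomputable def gap (h : ℝ) : ℕ := #{j ∈ Finset.range n | I.yAt j ≤ h}

/-- The `y`-coordinates of the points in increasing order, preceded by that of the bottom side and
followed by that of the top side of the rectangle. -/
noncomputable def level (g : ℕ) : ℝ :=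
  if g = 0 then I.ymin else if g ≤ n then I.yAt (nth n I.yAt (g - 1)) else I.ymax

variable {I} {k : ℕ}

theorem xAt_val (i : Fin n) : I.xAt i = (I.pt i).1 := by simp [xAt]

theorem yAt_val (i : Fin n) : I.yAt i = (I.pt i).2 := by simp [yAt]

theorem colorAt_val (i : Fin n) : I.colorAt i = I.color i := by simp [colorAt]

theorem injOn_neg_xAt : Set.InjOn (fun i => -I.xAt i) (Set.Iio n) := fun i hi j hj h => by
  have hi : i < n := hi
  have hj : j < n := hj
  simp only [xAt, hi, hj, dif_pos, neg_inj] at h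
  simpa using I.x_injective h

theorem injOn_yAt : Set.InjOn I.yAt (Set.Iio n) := fun i hi j hj h => by
  have hi : i < n := hi
  have hj : j < n := hj
  simp only [yAt, hi, hj, dif_pos] at h
  simpa using I.y_injective h

theorem yAt_mem_Ioo {i : ℕ} (hi : i < n) : I.yAt i ∈ Set.Ioo I.ymin I.ymax := by
  simpa [yAt, hi] using (I.pt_mem ⟨i, hi⟩).2

theorem ymin_lt_ymax (hn : 0 < n) : I.ymin < I.ymax :=
  (yAt_mem_Ioo hn).1.trans (yAt_mem_Ioo hn).2

theorem order_lt (hk : k < n) : I.order k < n := nth_lt injOn_neg_xAt hk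

variable (I) in
/-- Point `k` as an index of the input. -/
noncomputable def point (hk : k < n) : Fin n := ⟨I.order k, order_lt hk⟩

theorem xAt_order_lt_xAt_order {j : ℕ} (hjk : j < k) (hk : k < n) :
    I.xAt (I.order k) < I.xAt (I.order j) :=
  neg_lt_neg_iff.1 (apply_nth_lt_apply_nth injOn_neg_xAt hjk hk)

theorem sortedY_mem_Ioo (hk : k < n) : I.sortedY k ∈ Set.Ioo I.ymin I.ymax :=
  yAt_mem_Ioo (order_lt hk)

theorem sortedRank_lt (hk : k < n) : I.sortedRank k < n := rank_lt (order_lt hk)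

theorem sortedColor_lt (hk : k < n) : I.sortedColor k < m := by
  simp [sortedColor, colorAt, order_lt hk]

theorem gap_le {h : ℝ} : I.gap h ≤ n := (Finset.card_filter_le _ _).trans_eq (Finset.card_range n)

theorem gap_mono {h h' : ℝ} (hh : h ≤ h') : I.gap h ≤ I.gap h' :=
  Finset.card_le_card (Finset.monotone_filter_right _ fun _ _ hj => hj.trans hh)

theorem gap_le_sortedRank_iff (hk : k < n) (h : ℝ) :
    I.gap h ≤ I.sortedRank k ↔ h < I.sortedY k :=
  ⟨fun hle => not_le.1 fun hlt => (rank_lt_card_filter_le (order_lt hk) hlt).not_ge hle,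
    fun hlt => card_filter_le_le_rank hlt⟩

theorem gap_le_and_lt_gap_iff (hk : k < n) (a b : ℝ) :
    I.gap a ≤ I.sortedRank k ∧ I.sortedRank k < I.gap b ↔ I.sortedY k ∈ Set.Ioc a b := by
  rw [← not_le (a := I.gap b), gap_le_sortedRank_iff hk, gap_le_sortedRank_iff hk, not_lt,
    Set.mem_Ioc]

theorem level_succ_rank {i : ℕ} (hi : i < n) : I.level (rank n I.yAt i + 1) = I.yAt i := by
  simp [level, nth_rank injOn_yAt hi, Nat.succ_le_of_lt (rank_lt hi)]

theorem level_last : I.level (n + 1) = I.ymax := by simp [level]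

theorem level_strictMonoOn (hn : 0 < n) : StrictMonoOn I.level (Set.Iic (n + 1)) := by
  intro g _ g' (hg' : g' ≤ n + 1) hlt
  have hpy : ∀ {r}, r < n → I.yAt (nth n I.yAt r) ∈ Set.Ioo I.ymin I.ymax := fun hr =>
    yAt_mem_Ioo (nth_lt injOn_yAt hr)
  rcases Nat.eq_zero_or_pos g with rfl | h0 <;> rcases Nat.lt_or_ge n g' with hn' | hn'
  · simpa [level, hn'.not_ge, hlt.ne'] using ymin_lt_ymax hn
  · simpa [level, hn', hlt.ne'] using (hpy (show g' - 1 < n by omega)).1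
  · simpa [level, hn'.not_ge, h0.ne', (h0.trans hlt).ne', show g ≤ n by omega] using
      (hpy (show g - 1 < n by omega)).2
  · simpa [level, hn', h0.ne', (h0.trans hlt).ne', show g ≤ n by omega] using
      apply_nth_lt_apply_nth injOn_yAt (show g - 1 < g' - 1 by omega) (by omega)

end ColoredPoints

namespace ColoredPoints

variable {n m : ℕ} (I : ColoredPoints n m)

/-- The minimum number of backbones needed strictly between two consecutive backbones, given by
their heights and colors, for the points `0, …, k - 1` that lie between them. -/
noncomputable def minBetween (k : ℕ) (b t : ℝ × ℕ) : ℕ :=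
  minBackbones I.sortedRank I.sortedColor k (I.gap b.1, b.2) (I.gap t.1, t.2)

variable {I} {k : ℕ} {b t : ℝ × ℕ}

theorem minBetween_succ_of_notMem (hk : k < n) (h : I.sortedY k ∉ Set.Ioc b.1 t.1) :
    I.minBetween (k + 1) b t = I.minBetween k b t :=
  minBackbones_succ_of_not fun h' => h ((gap_le_and_lt_gap_iff hk _ _).1 h')

theorem minBetween_succ_le_of_color_eq (hk : k < n) (h : I.sortedY k ∈ Set.Ioc b.1 t.1)
    (hc : I.sortedColor k = b.2 ∨ I.sortedColor k = t.2) :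
    I.minBetween (k + 1) b t ≤ I.minBetween k b t :=
  minBackbones_succ_le (o := none) ((gap_le_and_lt_gap_iff hk _ _).2 h) hc

theorem minBetween_succ_le_of_mem_Ioo (hk : k < n) (h : I.sortedY k ∈ Set.Ioc b.1 t.1) {y : ℝ}
    (hy : y ∈ Set.Ioo b.1 t.1) :
    I.minBetween (k + 1) b t ≤
      I.minBetween k b (y, I.sortedColor k) + I.minBetween k (y, I.sortedColor k) t + 1 :=
  minBackbones_succ_le (o := some (I.gap y)) ((gap_le_and_lt_gap_iff hk _ _).2 h)
    ⟨gap_mono hy.1.le, gap_mono hy.2.le⟩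

end ColoredPoints

/-! ### The lower bound -/

theorem card_filter_Ioo_add_card_filter_Ioo_lt {ι α : Type*} [LinearOrder α] {s : Finset ι}
    {f : ι → α} {a b : α} {i : ι} (hi : i ∈ s) (hab : f i ∈ Set.Ioo a b) :
    #{j ∈ s | f j ∈ Set.Ioo a (f i)} + #{j ∈ s | f j ∈ Set.Ioo (f i) b} <
      #{j ∈ s | f j ∈ Set.Ioo a b} := by
  have hdisj : Disjoint {j ∈ s | f j ∈ Set.Ioo a (f i)} {j ∈ s | f j ∈ Set.Ioo (f i) b} :=
    Finset.disjoint_filter.2 fun j _ h h' => h.2.not_gt h'.1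
  classical
  rw [← Finset.card_union_of_disjoint hdisj, ← Finset.filter_or]
  refine Finset.card_lt_card (Finset.ssubset_iff_of_subset ?_ |>.2
    ⟨i, by simp only [Finset.mem_filter, hi, hab, and_self], by simp⟩)
  refine Finset.monotone_filter_right _ fun j _ h => h.elim ?_ ?_
  · exact fun h => ⟨h.1, h.2.trans hab.2⟩
  · exact fun h => ⟨hab.1.trans h.1, h.2⟩

section LowerBound

variable {n m : ℕ} {I : ColoredPoints n m} {L : Labeling n m}

open ColoredPoints

theorem ColoredPoints.IsCrossingFree.y_notMem_uIcc (hL : I.IsCrossingFree L) {i j : Fin n}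
    (hx : (I.pt i).1 ≤ (I.pt j).1) (hij : L.assign i ≠ L.assign j) :
    L.y (L.assign i) ∉ Set.uIcc (I.pt j).2 (L.y (L.assign j)) := by
  intro hmem
  have hback : ((I.pt j).1, L.y (L.assign i)) ∈ I.backbone L (L.assign i) :=
    ⟨rfl, (I.pt_mem j).1.2.le, i, rfl, hx⟩
  have hconn : ((I.pt j).1, L.y (L.assign i)) ∈ I.connector L j := ⟨rfl, hmem⟩
  exact Set.disjoint_left.1 (hL.disjoint _ _ hij) (.inl hback)
    (.inr (Set.mem_biUnion (x := j) rfl hconn))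

variable (I L) in
/-- Label `l` is active at stage `k` if a point with at least `k` points to its right is assigned
to it, so that its backbone meets the vertical lines through the points `0, …, k - 1`. -/
def IsActive (k : ℕ) (l : Fin L.numLabels) : Prop :=
  ∃ j, k ≤ j ∧ ∃ hj : j < n, L.assign (I.point hj) = l

variable (I L) in
/-- The pair `b` of a height and a color is a barrier at stage `k` if it belongs to an active
label; any height outside the rectangle is also a barrier. -/
def IsBarrier (k : ℕ) (b : ℝ × ℕ) : Prop :=
  b.1 ∉ Set.Icc I.ymin I.ymax ∨ ∃ l, IsActive I L k l ∧ (L.y l, (L.color l : ℕ)) = b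

variable {k : ℕ} {b t : ℝ × ℕ}

theorem isActive_iff_of_lt (hk : k < n) {l : Fin L.numLabels} :
    IsActive I L k l ↔ l = L.assign (I.point hk) ∨ IsActive I L (k + 1) l := by
  constructor
  · rintro ⟨j, hkj, hj, rfl⟩
    rcases hkj.eq_or_lt with rfl | hlt
    · exact .inl rfl
    · exact .inr ⟨j, hlt, hj, rfl⟩
  · rintro (rfl | ⟨j, hkj, h⟩)
    · exact ⟨k, le_rfl, hk, rfl⟩
    · exact ⟨j, by omega, h⟩

theorem IsBarrier.of_succ (hk : k < n) (h : IsBarrier I L (k + 1) b) : IsBarrier I L k b :=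
  h.imp_right fun ⟨l, hl, hb⟩ => ⟨l, (isActive_iff_of_lt hk).2 (.inr hl), hb⟩

theorem IsBarrier.eq_of_mem_uIcc (hL : I.IsCrossingFree L) (hk : k < n)
    (hb : IsBarrier I L (k + 1) b)
    (hmem : b.1 ∈ Set.uIcc (I.sortedY k) (L.y (L.assign (I.point hk)))) :
    b = (L.y (L.assign (I.point hk)), I.sortedColor k) := by
  have hcolor : (L.color (L.assign (I.point hk)) : ℕ) = I.sortedColor k := by
    rw [hL.color_eq, ← colorAt_val]
    rfl
  rcases hb with hb | ⟨l, ⟨j, hkj, hj, rfl⟩, rfl⟩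
  · have hY := Set.Ioo_subset_Icc_self (I.sortedY_mem_Ioo hk)
    exact absurd (Set.uIcc_subset_Icc hY (hL.y_mem _) hmem) hb
  · by_contra hne
    have hx := (xAt_order_lt_xAt_order (I := I) (show k < j from hkj) hj).le
    refine hL.y_notMem_uIcc (i := I.point hj) (j := I.point hk) ?_ (fun h => hne ?_) ?_
    · rwa [← xAt_val, ← xAt_val]
    · rw [h, hcolor]
    · rwa [← yAt_val]

theorem isBarrier_assign (hL : I.IsCrossingFree L) (hk : k < n) :
    IsBarrier I L k (L.y (L.assign (I.point hk)), I.sortedColor k) := by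
  refine .inr ⟨_, (isActive_iff_of_lt hk).2 (.inl rfl), Prod.ext rfl ?_⟩
  rw [hL.color_eq, ← colorAt_val]
  rfl

theorem sortedY_mem_Ioc_of_mem_Ioo (hL : I.IsCrossingFree L) (hk : k < n)
    (hb : IsBarrier I L (k + 1) b) (ht : IsBarrier I L (k + 1) t)
    (hl : L.y (L.assign (I.point hk)) ∈ Set.Ioo b.1 t.1) : I.sortedY k ∈ Set.Ioc b.1 t.1 := by
  constructor
  · by_contra! h
    exact hl.1.ne <| congrArg Prod.fst <|
      hb.eq_of_mem_uIcc hL hk (Set.mem_uIcc.2 (.inl ⟨h, hl.1.le⟩))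
  · by_contra! h
    exact hl.2.ne' <| congrArg Prod.fst <|
      ht.eq_of_mem_uIcc hL hk (Set.mem_uIcc.2 (.inr ⟨hl.2.le, h.le⟩))

theorem sortedColor_eq_of_notMem_Ioo (hL : I.IsCrossingFree L) (hk : k < n)
    (hb : IsBarrier I L (k + 1) b) (ht : IsBarrier I L (k + 1) t)
    (hY : I.sortedY k ∈ Set.Ioc b.1 t.1)
    (hl : L.y (L.assign (I.point hk)) ∉ Set.Ioo b.1 t.1) :
    I.sortedColor k = b.2 ∨ I.sortedColor k = t.2 := by
  rcases le_or_gt (L.y (L.assign (I.point hk))) b.1 with h | h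
  · exact .inl <| Eq.symm <| congrArg Prod.snd <|
      hb.eq_of_mem_uIcc hL hk (Set.mem_uIcc.2 (.inr ⟨h, hY.1.le⟩))
  · have h' : t.1 ≤ L.y (L.assign (I.point hk)) := not_lt.1 fun h' => hl ⟨h, h'⟩
    exact .inr <| Eq.symm <| congrArg Prod.snd <|
      ht.eq_of_mem_uIcc hL hk (Set.mem_uIcc.2 (.inl ⟨hY.2, h'⟩))

theorem minBetween_le_card (hL : I.IsCrossingFree L) (hk : k ≤ n) (hb : IsBarrier I L k b)
    (ht : IsBarrier I L k t) (hadj : ∀ l, IsActive I L k l → L.y l ∉ Set.Ioo b.1 t.1) :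
    I.minBetween k b t ≤ #{l | L.y l ∈ Set.Ioo b.1 t.1} := by
  induction k generalizing b t with
  | zero => exact Nat.zero_le _
  | succ k ih =>
    have hk : k < n := hk
    set l := L.assign (I.point hk)
    have hbarrier := isBarrier_assign hL hk
    have hactive {l'} (hl' : IsActive I L k l') (hmem : L.y l' ∈ Set.Ioo b.1 t.1) : l' = l :=
      ((isActive_iff_of_lt hk).1 hl').resolve_right fun h => hadj l' h hmem
    by_cases hl : L.y l ∈ Set.Ioo b.1 t.1
    · have hY := sortedY_mem_Ioc_of_mem_Ioo hL hk hb ht hl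
      have hlow := ih hk.le (hb.of_succ hk) hbarrier fun l' hl' h =>
        h.2.ne (congrArg L.y (hactive hl' ⟨h.1, h.2.trans hl.2⟩))
      have hhigh := ih hk.le hbarrier (ht.of_succ hk) fun l' hl' h =>
        h.1.ne' (congrArg L.y (hactive hl' ⟨hl.1.trans h.1, h.2⟩))
      have hsplit := minBetween_succ_le_of_mem_Ioo hk hY hl
      have hcard := card_filter_Ioo_add_card_filter_Ioo_lt (Finset.mem_univ l) hl
      lia
    · refine le_trans ?_ (ih hk.le (hb.of_succ hk) (ht.of_succ hk) fun l' hl' h =>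
        hl (hactive hl' h ▸ h))
      by_cases hY : I.sortedY k ∈ Set.Ioc b.1 t.1
      · exact minBetween_succ_le_of_color_eq hk hY
          (sortedColor_eq_of_notMem_Ioo hL hk hb ht hY hl)
      · exact (minBetween_succ_of_notMem hk hY).le

end LowerBound

/-! ### Consecutive backbones -/

section Adjacent

variable {α β : Type*} [LinearOrder α] {B : Finset (α × β)} {b t c x y : α × β} {a : α}

/-- The backbones `b` and `t`, given by their heights and colors, are consecutive among those of
`B`. -/
structure Adjacent (B : Finset (α × β)) (b t : α × β) : Prop where
  left_mem : b ∈ B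
  right_mem : t ∈ B
  lt : b.1 < t.1
  notMem_Ioo : ∀ c ∈ B, c.1 ∉ Set.Ioo b.1 t.1

theorem Adjacent.eq_and_eq_of_mem_Ioc (hB : Set.InjOn Prod.fst (B : Set (α × β)))
    (h : Adjacent B b t) (h' : Adjacent B x y) (ha : a ∈ Set.Ioc b.1 t.1)
    (ha' : a ∈ Set.Ioc x.1 y.1) : x = b ∧ y = t := by
  constructor
  · refine hB h'.left_mem h.left_mem (le_antisymm ?_ ?_)
    · exact not_lt.1 fun hlt => h.notMem_Ioo x h'.left_mem ⟨hlt, ha'.1.trans_le ha.2⟩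
    · exact not_lt.1 fun hlt => h'.notMem_Ioo b h.left_mem ⟨hlt, ha.1.trans_le ha'.2⟩
  · refine hB h'.right_mem h.right_mem (le_antisymm ?_ ?_)
    · exact not_lt.1 fun hlt => h'.notMem_Ioo t h.right_mem ⟨ha'.1.trans_le ha.2, hlt⟩
    · exact not_lt.1 fun hlt => h.notMem_Ioo y h'.right_mem ⟨ha.1.trans_le ha'.2, hlt⟩

theorem Adjacent.fst_eq_of_mem_uIcc (h : Adjacent B b t) (ha : a ∈ Set.Ioo b.1 t.1) {a' : α}
    (ha' : a' ∈ Set.Icc b.1 t.1) (hc : c ∈ B) (hmem : c.1 ∈ Set.uIcc a a') : c.1 = a' := by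
  have hIcc := Set.uIcc_subset_Icc (Set.Ioo_subset_Icc_self ha) ha' hmem
  rw [Set.mem_uIcc] at hmem
  rcases hIcc.1.eq_or_lt with hb | hb
  · grind
  · have ht : c.1 = t.1 := hIcc.2.eq_of_not_lt fun ht => h.notMem_Ioo c hc ⟨hb, ht⟩
    grind

theorem Adjacent.insert_of_notMem_Ioo [DecidableEq (α × β)] (h : Adjacent B b t)
    (hc : c.1 ∉ Set.Ioo b.1 t.1) :
    Adjacent (insert c B) b t :=
  ⟨Finset.mem_insert_of_mem h.left_mem, Finset.mem_insert_of_mem h.right_mem, h.lt,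
    (Finset.forall_mem_insert _ _ _).2 ⟨hc, h.notMem_Ioo⟩⟩

theorem Adjacent.insert_left [DecidableEq (α × β)] (h : Adjacent B b t)
    (hc : c.1 ∈ Set.Ioo b.1 t.1) :
    Adjacent (insert c B) c t :=
  ⟨Finset.mem_insert_self c B, Finset.mem_insert_of_mem h.right_mem, hc.2,
    (Finset.forall_mem_insert _ _ _).2 ⟨fun hmem => hmem.1.false,
      fun x hx hmem => h.notMem_Ioo x hx ⟨hc.1.trans hmem.1, hmem.2⟩⟩⟩

theorem Adjacent.insert_right [DecidableEq (α × β)] (h : Adjacent B b t)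
    (hc : c.1 ∈ Set.Ioo b.1 t.1) :
    Adjacent (insert c B) b c :=
  ⟨Finset.mem_insert_of_mem h.left_mem, Finset.mem_insert_self c B, hc.1,
    (Finset.forall_mem_insert _ _ _).2 ⟨fun hmem => hmem.2.false,
      fun x hx hmem => h.notMem_Ioo x hx ⟨hmem.1, hmem.2.trans hc.2⟩⟩⟩

theorem adjacent_insert_iff [DecidableEq (α × β)] (hB : Set.InjOn Prod.fst (B : Set (α × β)))
    (h : Adjacent B b t) (hc : c.1 ∈ Set.Ioo b.1 t.1) :
    Adjacent (insert c B) x y ↔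
      (x = b ∧ y = c) ∨ (x = c ∧ y = t) ∨ (Adjacent B x y ∧ ¬ (x = b ∧ y = t)) := by
  constructor
  · rintro ⟨hx, hy, hxy, hnot⟩
    rw [Finset.forall_mem_insert] at hnot
    rcases Finset.mem_insert.1 hx with rfl | hxB <;>
      rcases Finset.mem_insert.1 hy with rfl | hyB
    · exact absurd hxy (lt_irrefl _)
    · exact .inr <| .inl ⟨rfl, hB hyB h.right_mem <| le_antisymm
        (not_lt.1 fun hlt => hnot.2 t h.right_mem ⟨hc.2, hlt⟩)
        (not_lt.1 fun hlt => h.notMem_Ioo y hyB ⟨hc.1.trans hxy, hlt⟩)⟩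
    · exact .inl ⟨hB hxB h.left_mem <| le_antisymm
        (not_lt.1 fun hlt => h.notMem_Ioo x hxB ⟨hlt, hxy.trans hc.2⟩)
        (not_lt.1 fun hlt => hnot.2 b h.left_mem ⟨hlt, hc.1⟩), rfl⟩
    · refine .inr (.inr ⟨⟨hxB, hyB, hxy, hnot.2⟩, ?_⟩)
      rintro ⟨rfl, rfl⟩
      exact hnot.1 hc
  · rintro (⟨rfl, rfl⟩ | ⟨rfl, rfl⟩ | ⟨hadj, hne⟩)
    · exact h.insert_right hc
    · exact h.insert_left hc
    · exact hadj.insert_of_notMem_Ioo fun hmem => hne <| h.eq_and_eq_of_mem_Ioc hB hadj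
        (Set.Ioo_subset_Ioc_self hc) (Set.Ioo_subset_Ioc_self hmem)

open scoped Classical in
/-- The pairs of consecutive backbones of `B`. -/
noncomputable def adjacentPairs (B : Finset (α × β)) : Finset ((α × β) × (α × β)) :=
  {p ∈ B ×ˢ B | Adjacent B p.1 p.2}

theorem mem_adjacentPairs {p : (α × β) × (α × β)} :
    p ∈ adjacentPairs B ↔ Adjacent B p.1 p.2 := by
  simp only [adjacentPairs, Finset.mem_filter, Finset.mem_product, and_iff_right_iff_imp]
  exact fun h => ⟨h.left_mem, h.right_mem⟩

theorem sum_adjacentPairs_insert [DecidableEq (α × β)] {M : Type*} [AddCommMonoid M]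
    (F : α × β → α × β → M) (hB : Set.InjOn Prod.fst (B : Set (α × β))) (h : Adjacent B b t)
    (hc : c.1 ∈ Set.Ioo b.1 t.1) :
    ∑ p ∈ adjacentPairs (insert c B), F p.1 p.2 + F b t =
      ∑ p ∈ adjacentPairs B, F p.1 p.2 + (F b c + F c t) := by
  have hcB : c ∉ B := fun hcB => h.notMem_Ioo c hcB hc
  have heq : adjacentPairs (insert c B) =
      insert (b, c) (insert (c, t) ((adjacentPairs B).erase (b, t))) := by
    ext p
    simp only [Finset.mem_insert, Finset.mem_erase, mem_adjacentPairs, adjacent_insert_iff hB h hc,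
      Prod.ext_iff (x := p), ne_eq]
    tauto
  have hbc : (b, c) ∉ insert (c, t) ((adjacentPairs B).erase (b, t)) := by
    simp only [Finset.mem_insert, Prod.mk.injEq, Finset.mem_erase, mem_adjacentPairs, not_or]
    exact ⟨fun h' => hcB (h'.1 ▸ h.left_mem), fun h' => hcB h'.2.right_mem⟩
  have hct : (c, t) ∉ (adjacentPairs B).erase (b, t) := fun h' =>
    hcB (mem_adjacentPairs.1 (Finset.mem_of_mem_erase h')).left_mem
  rw [heq, Finset.sum_insert hbc, Finset.sum_insert hct,
    ← Finset.sum_erase_add _ (fun p => F p.1 p.2) (mem_adjacentPairs (p := (b, t)).2 h)]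
  abel

end Adjacent

namespace ColoredPoints

variable {n m : ℕ} (I : ColoredPoints n m)

/-- The bottom side of the rectangle, seen as a backbone of a color that no point has. -/
def bottom : ℝ × ℕ := (I.ymin, m)

/-- The top side of the rectangle, seen as a backbone of a color that no point has. -/
def top : ℝ × ℕ := (I.ymax, m)

/-- The number of backbones in `B`, with those that are still needed for the points `0, …, k - 1`.
The sides of the rectangle are counted as backbones. -/
noncomputable def total (k : ℕ) (B : Finset (ℝ × ℕ)) : ℕ :=
  #B + ∑ p ∈ adjacentPairs B, I.minBetween k p.1 p.2

variable {I} {k : ℕ} {B : Finset (ℝ × ℕ)} {b t : ℝ × ℕ}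

theorem gap_eq_zero {h : ℝ} (hh : h ≤ I.ymin) : I.gap h = 0 := by
  rw [gap, Finset.card_eq_zero, Finset.filter_eq_empty_iff]
  exact fun j hj => (hh.trans_lt (yAt_mem_Ioo (Finset.mem_range.1 hj)).1).not_ge

theorem gap_eq_n {h : ℝ} (hh : I.ymax ≤ h) : I.gap h = n := by
  rw [gap, Finset.filter_true_of_mem, Finset.card_range]
  exact fun j hj => (yAt_mem_Ioo (Finset.mem_range.1 hj)).2.le.trans hh

theorem minBetween_bottom_top_le_numLabels {L : Labeling n m} (hL : I.IsCrossingFree L) :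
    I.minBetween n I.bottom I.top ≤ L.numLabels := by
  have hbelow : I.ymin - 1 < I.ymin := by linarith
  have habove : I.ymax < I.ymax + 1 := by linarith
  have h := minBetween_le_card hL le_rfl (b := (I.ymin - 1, m)) (t := (I.ymax + 1, m))
    (.inl fun h => h.1.not_gt hbelow) (.inl fun h => h.2.not_gt habove)
    fun l ⟨j, hnj, hj, _⟩ => absurd hj hnj.not_gt
  simp only [minBetween, gap_eq_zero hbelow.le, gap_eq_n habove.le] at h
  simp only [minBetween, bottom, top, gap_eq_zero le_rfl, gap_eq_n le_rfl]
  exact h.trans ((Finset.card_filter_le _ _).trans_eq (Fintype.card_fin _))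

section total

variable (hk : k < n) (hB : Set.InjOn Prod.fst (B : Set (ℝ × ℕ))) (h : Adjacent B b t)
  (hY : I.sortedY k ∈ Set.Ioc b.1 t.1)

include hk hB h hY

theorem sum_adjacentPairs_minBetween_succ :
    ∑ p ∈ adjacentPairs B, I.minBetween (k + 1) p.1 p.2 + I.minBetween k b t =
      ∑ p ∈ adjacentPairs B, I.minBetween k p.1 p.2 + I.minBetween (k + 1) b t := by
  have hbt : (b, t) ∈ adjacentPairs B := mem_adjacentPairs.2 h
  have hother : ∑ p ∈ (adjacentPairs B).erase (b, t), I.minBetween (k + 1) p.1 p.2 =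
      ∑ p ∈ (adjacentPairs B).erase (b, t), I.minBetween k p.1 p.2 := by
    refine Finset.sum_congr rfl fun p hp => minBetween_succ_of_notMem hk fun hY' => ?_
    rw [Finset.mem_erase, mem_adjacentPairs] at hp
    have heq := h.eq_and_eq_of_mem_Ioc hB hp.2 hY hY'
    exact hp.1 (Prod.ext heq.1 heq.2)
  rw [← Finset.sum_erase_add _ _ hbt, hother, ← Finset.sum_erase_add _ _ hbt]
  abel

theorem total_of_connect
    (ho : IsOptimalDecision I.sortedRank I.sortedColor k (I.gap b.1, b.2) (I.gap t.1, t.2) none) :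
    I.total k B = I.total (k + 1) B := by
  have hcost : I.minBetween (k + 1) b t = I.minBetween k b t := ho.cost_eq
  have hsum := sum_adjacentPairs_minBetween_succ hk hB h hY
  simp only [total]
  lia

theorem total_insert {y : ℝ} (hy : y ∈ Set.Ioo b.1 t.1)
    (ho : IsOptimalDecision I.sortedRank I.sortedColor k (I.gap b.1, b.2) (I.gap t.1, t.2)
      (some (I.gap y))) :
    I.total k (insert (y, I.sortedColor k) B) = I.total (k + 1) B := by
  have hcost : I.minBetween (k + 1) b t = I.minBetween k b (y, I.sortedColor k) +
      I.minBetween k (y, I.sortedColor k) t + 1 := ho.cost_eq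
  have hsum := sum_adjacentPairs_minBetween_succ hk hB h hY
  have hins := sum_adjacentPairs_insert (c := (y, I.sortedColor k)) (I.minBetween k) hB h hy
  have hcard := Finset.card_insert_of_notMem (s := B) fun hmem =>
    h.notMem_Ioo (y, I.sortedColor k) hmem hy
  simp only [total]
  lia

end total

end ColoredPoints

namespace ColoredPoints

variable {n m : ℕ} {I : ColoredPoints n m} {k g : ℕ} {h y : ℝ}

theorem order_injOn : Set.InjOn I.order (Set.Iio n) := fun _ hj _ hk hjk => by
  simpa only [order, rank_nth injOn_neg_xAt hj, rank_nth injOn_neg_xAt hk] using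
    congrArg (rank n fun i => -I.xAt i) hjk

theorem exists_point_eq (i : Fin n) : ∃ k, ∃ hk : k < n, I.point hk = i :=
  ⟨_, rank_lt i.2, Fin.ext (nth_rank injOn_neg_xAt i.2)⟩

theorem level_sortedRank_succ (hk : k < n) : I.level (I.sortedRank k + 1) = I.sortedY k :=
  level_succ_rank (order_lt hk)

theorem exists_sortedY_eq_level_succ (hg : g < n) :
    ∃ k < n, I.sortedRank k = g ∧ I.sortedY k = I.level (g + 1) := by
  have hlt : nth n I.yAt g < n := nth_lt injOn_yAt hg
  obtain ⟨k, hk, heq⟩ := exists_point_eq (I := I) ⟨_, hlt⟩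
  have heq : I.order k = nth n I.yAt g := congrArg Fin.val heq
  have hrank : I.sortedRank k = g := by rw [sortedRank, heq, rank_nth injOn_yAt hg]
  exact ⟨k, hk, hrank, by rw [← level_sortedRank_succ hk, hrank]⟩

theorem level_lt_of_le_gap (hg : g ≤ I.gap h) (hmin : I.ymin < h)
    (hne : ∀ k < n, h ≠ I.sortedY k) : I.level g < h := by
  cases g with
  | zero => exact hmin
  | succ g =>
    obtain ⟨k, hk, rfl, hY⟩ := exists_sortedY_eq_level_succ (I := I) (hg.trans gap_le)
    rw [← hY]
    exact (hne k hk).symm.lt_of_le (not_lt.1 fun hlt =>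
      hg.not_gt (Nat.lt_succ_of_le ((gap_le_sortedRank_iff hk h).2 hlt)))

theorem lt_level_succ_of_gap_le (hg : I.gap h ≤ g) (hgn : g ≤ n) (hmax : h < I.ymax) :
    h < I.level (g + 1) := by
  rcases hgn.eq_or_lt with rfl | hgn
  · rwa [level_last]
  · obtain ⟨k, hk, rfl, hY⟩ := exists_sortedY_eq_level_succ (I := I) hgn
    rw [← hY]
    exact (gap_le_sortedRank_iff hk h).1 hg

section level

variable (hn : 0 < n) (hg : g ≤ n) (hy : y ∈ Set.Ioo (I.level g) (I.level (g + 1)))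

include hn hg hy

theorem ne_sortedY_of_mem_Ioo_level : ∀ k < n, y ≠ I.sortedY k := by
  rintro k hk rfl
  rw [← level_sortedRank_succ hk] at hy
  have hr := sortedRank_lt (I := I) hk
  have hmono := level_strictMonoOn (I := I) hn
  have hlow := (hmono.lt_iff_lt (show g ≤ n + 1 by omega)
    (show I.sortedRank k + 1 ≤ n + 1 by omega)).1 hy.1
  have hhigh := (hmono.lt_iff_lt (show I.sortedRank k + 1 ≤ n + 1 by omega)
    (show g + 1 ≤ n + 1 by omega)).1 hy.2
  omega

theorem gap_eq_of_mem_Ioo_level : I.gap y = g := by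
  have hmono := (level_strictMonoOn (I := I) hn).monotoneOn
  have hmin : I.ymin < y :=
    (hmono (show 0 ≤ n + 1 by omega) (show g ≤ n + 1 by omega) g.zero_le).trans_lt hy.1
  have hmax : y < I.ymax := hy.2.trans_le <| level_last (I := I) ▸
    hmono (show g + 1 ≤ n + 1 by omega) (show n + 1 ≤ n + 1 from le_rfl) (by omega)
  refine le_antisymm (not_lt.1 fun hlt => ?_) (not_lt.1 fun hlt => ?_)
  · exact hy.2.not_gt (level_lt_of_le_gap hlt hmin (ne_sortedY_of_mem_Ioo_level hn hg hy))
  · refine hy.1.not_ge ((lt_level_succ_of_gap_le le_rfl (by omega) hmax).le.trans ?_)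
    exact hmono (show I.gap y + 1 ≤ n + 1 by omega) (show g ≤ n + 1 by omega) hlt

end level

theorem isCrossingFree_of_notMem_uIcc {L : Labeling n m}
    (y_mem : ∀ l, L.y l ∈ Set.Icc I.ymin I.ymax)
    (color_eq : ∀ i, L.color (L.assign i) = I.color i) (y_inj : Function.Injective L.y)
    (notMem_uIcc : ∀ i j, (I.pt i).1 ≤ (I.pt j).1 → L.assign i ≠ L.assign j →
      L.y (L.assign i) ∉ Set.uIcc (I.pt j).2 (L.y (L.assign j))) :
    I.IsCrossingFree L := by
  have hcross {l : Fin L.numLabels} {j : Fin n} (hlj : l ≠ L.assign j) :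
      Disjoint (I.backbone L l) (I.connector L j) := by
    refine Set.disjoint_left.2 fun z ⟨hz, _, i, hi, hix⟩ ⟨hzj, hzy⟩ => ?_
    subst hi
    exact notMem_uIcc i j (hix.trans_eq hzj) hlj (hz ▸ hzy)
  refine ⟨y_mem, color_eq, fun l l' hll' => Set.disjoint_left.2 ?_⟩
  rintro z (hz | hz) (hz' | hz')
  · exact hll' (y_inj (hz.1.symm.trans hz'.1))
  · obtain ⟨j, rfl, hj⟩ := Set.mem_iUnion₂.1 hz'
    exact Set.disjoint_left.1 (hcross hll') hz hj
  · obtain ⟨i, rfl, hi⟩ := Set.mem_iUnion₂.1 hz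
    exact Set.disjoint_left.1 (hcross hll'.symm) hz' hi
  · obtain ⟨i, rfl, hi⟩ := Set.mem_iUnion₂.1 hz
    obtain ⟨j, rfl, hj⟩ := Set.mem_iUnion₂.1 hz'
    exact hll' (congrArg L.assign (I.x_injective (hi.1.symm.trans hj.1)))

end ColoredPoints

/-! ### Placing the backbones from left to right -/

/-- The labels placed so far, given by their heights and colors, and the labels of the points. -/
@[ext]
structure Sweep where
  numLabels : ℕ
  label : ℕ → ℝ × ℕ
  assign : ℕ → ℕ

namespace Sweep

open ColoredPoints

variable {n m : ℕ} (I : ColoredPoints n m) (w : Sweep) {k l : ℕ} {b t : ℝ × ℕ}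

/-- The backbones of the labels placed so far, with the sides of the rectangle. -/
noncomputable def backbones : Finset (ℝ × ℕ) :=
  insert I.bottom (insert I.top ((Finset.range w.numLabels).image w.label))

/-- The labels placed so far and the assignment of the points `k, …, n - 1` form a crossing-free
labeling of these points, with labels in general position. -/
structure IsValid (k : ℕ) : Prop where
  height_mem : ∀ l < w.numLabels, (w.label l).1 ∈ Set.Ioo I.ymin I.ymax
  height_ne : ∀ l < w.numLabels, ∀ j < n, (w.label l).1 ≠ I.sortedY j
  color_lt : ∀ l < w.numLabels, (w.label l).2 < m
  height_injOn : Set.InjOn (fun l => (w.label l).1) (Set.Iio w.numLabels)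
  assign_lt : ∀ j, k ≤ j → j < n → w.assign (I.order j) < w.numLabels
  color_assign : ∀ j, k ≤ j → j < n → (w.label (w.assign (I.order j))).2 = I.sortedColor j
  notMem_uIcc : ∀ i j, k ≤ j → j ≤ i → i < n → w.assign (I.order i) ≠ w.assign (I.order j) →
    (w.label (w.assign (I.order i))).1 ∉
      Set.uIcc (I.sortedY j) (w.label (w.assign (I.order j))).1

/-- Assign point `i` to label `l`. -/
def connect (i l : ℕ) : Sweep := { w with assign := Function.update w.assign i l }

/-- Place a new label. -/
def addLabel (c : ℝ × ℕ) : Sweep :=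
  { w with numLabels := w.numLabels + 1, label := Function.update w.label w.numLabels c }

variable {I w}

theorem mem_backbones {c : ℝ × ℕ} :
    c ∈ w.backbones I ↔ c = I.bottom ∨ c = I.top ∨ ∃ l < w.numLabels, w.label l = c := by
  simp [backbones]

theorem label_mem_backbones (hl : l < w.numLabels) : w.label l ∈ w.backbones I :=
  mem_backbones.2 (.inr (.inr ⟨l, hl, rfl⟩))

theorem addLabel_label_of_lt {c : ℝ × ℕ} (hl : l < w.numLabels) :
    (w.addLabel c).label l = w.label l :=
  Function.update_of_ne hl.ne _ _

theorem addLabel_label_numLabels {c : ℝ × ℕ} : (w.addLabel c).label w.numLabels = c :=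
  Function.update_self ..

theorem backbones_addLabel {c : ℝ × ℕ} :
    (w.addLabel c).backbones I = insert c (w.backbones I) := by
  have himage : (Finset.range w.numLabels).image (w.addLabel c).label =
      (Finset.range w.numLabels).image w.label :=
    Finset.image_congr fun l hl => addLabel_label_of_lt (Finset.mem_range.1 hl)
  rw [backbones, show (w.addLabel c).numLabels = w.numLabels + 1 from rfl, Finset.range_add_one,
    Finset.image_insert, himage, addLabel_label_numLabels, Finset.insert_comm I.top,
    Finset.insert_comm I.bottom, backbones]

namespace IsValid

theorem fst_mem_Icc (hn : 0 < n) (hw : w.IsValid I k) {c : ℝ × ℕ} (hc : c ∈ w.backbones I) :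
    c.1 ∈ Set.Icc I.ymin I.ymax := by
  have hlt := ymin_lt_ymax (I := I) hn
  rcases mem_backbones.1 hc with rfl | rfl | ⟨l, hl, rfl⟩
  · exact Set.left_mem_Icc.2 hlt.le
  · exact Set.right_mem_Icc.2 hlt.le
  · exact Set.Ioo_subset_Icc_self (hw.height_mem l hl)

theorem fst_ne_sortedY (hw : w.IsValid I k) {c : ℝ × ℕ} (hc : c ∈ w.backbones I) :
    ∀ j < n, c.1 ≠ I.sortedY j := by
  intro j hj
  rcases mem_backbones.1 hc with rfl | rfl | ⟨l, hl, rfl⟩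
  · exact (sortedY_mem_Ioo hj).1.ne
  · exact (sortedY_mem_Ioo hj).2.ne'
  · exact hw.height_ne l hl j hj

theorem injOn_fst (hn : 0 < n) (hw : w.IsValid I k) :
    Set.InjOn Prod.fst (w.backbones I : Set (ℝ × ℕ)) := by
  have hlt := ymin_lt_ymax (I := I) hn
  intro c hc d hd hcd
  rcases mem_backbones.1 (Finset.mem_coe.1 hc) with rfl | rfl | ⟨l, hl, rfl⟩ <;>
    rcases mem_backbones.1 (Finset.mem_coe.1 hd) with rfl | rfl | ⟨l', hl', rfl⟩
  · rfl
  · exact absurd hcd hlt.ne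
  · exact absurd hcd (hw.height_mem l' hl').1.ne
  · exact absurd hcd hlt.ne'
  · rfl
  · exact absurd hcd (hw.height_mem l' hl').2.ne'
  · exact absurd hcd (hw.height_mem l hl).1.ne'
  · exact absurd hcd (hw.height_mem l hl).2.ne
  · rw [hw.height_injOn hl hl' hcd]

theorem connect (hw : w.IsValid I (k + 1)) (hk : k < n) (hl : l < w.numLabels)
    (hcolor : (w.label l).2 = I.sortedColor k)
    (hcross : ∀ l' < w.numLabels, l' ≠ l →
      (w.label l').1 ∉ Set.uIcc (I.sortedY k) (w.label l).1) :
    (w.connect (I.order k) l).IsValid I k := by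
  have hself : (w.connect (I.order k) l).assign (I.order k) = l := Function.update_self ..
  have hother {j : ℕ} (hkj : k < j) (hj : j < n) :
      (w.connect (I.order k) l).assign (I.order j) = w.assign (I.order j) :=
    Function.update_of_ne (fun h => hkj.ne' (order_injOn hj hk h)) _ _
  refine ⟨hw.height_mem, hw.height_ne, hw.color_lt, hw.height_injOn, fun j hkj hj => ?_,
    fun j hkj hj => ?_, fun i j hkj hji hi hne => ?_⟩
  · rcases hkj.eq_or_lt with rfl | hkj
    · rwa [hself]
    · rw [hother hkj hj]
      exact hw.assign_lt j hkj hj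
  · rcases hkj.eq_or_lt with rfl | hkj
    · rwa [hself]
    · rw [hother hkj hj]
      exact hw.color_assign j hkj hj
  · rcases hkj.eq_or_lt with rfl | hkj
    · have hki : k < i := hji.lt_of_ne fun h => hne (h ▸ rfl)
      rw [hself, hother hki hi] at hne ⊢
      exact hcross _ (hw.assign_lt i hki hi) hne
    · rw [hother hkj (hji.trans_lt hi), hother (hkj.trans_le hji) hi] at hne ⊢
      exact hw.notMem_uIcc i j hkj hji hi hne

theorem addLabel (hw : w.IsValid I k) {c : ℝ × ℕ} (hmem : c.1 ∈ Set.Ioo I.ymin I.ymax)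
    (hne : ∀ j < n, c.1 ≠ I.sortedY j) (hcolor : c.2 < m)
    (hnew : ∀ l < w.numLabels, (w.label l).1 ≠ c.1) :
    (w.addLabel c).IsValid I k := by
  have hforall (p : ℝ × ℕ → Prop) (hp : ∀ l < w.numLabels, p (w.label l)) (hc : p c) :
      ∀ l < w.numLabels + 1, p ((w.addLabel c).label l) := fun l hl => by
    rcases (Nat.le_of_lt_succ hl).eq_or_lt with rfl | hl
    · rwa [addLabel_label_numLabels]
    · rw [addLabel_label_of_lt hl]
      exact hp l hl
  have hassign {j : ℕ} (hkj : k ≤ j) (hj : j < n) :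
      (w.addLabel c).label (w.assign (I.order j)) = w.label (w.assign (I.order j)) :=
    addLabel_label_of_lt (hw.assign_lt j hkj hj)
  refine ⟨hforall (·.1 ∈ _) hw.height_mem hmem,
    hforall (fun d => ∀ j < n, d.1 ≠ I.sortedY j) hw.height_ne hne,
    hforall (·.2 < m) hw.color_lt hcolor, ?_,
    fun j hkj hj => (hw.assign_lt j hkj hj).trans (Nat.lt_succ_self _),
    fun j hkj hj => ?_, fun i j hkj hji hi hij => ?_⟩
  · intro l hl l' hl' heq
    rcases (Nat.le_of_lt_succ hl).eq_or_lt with rfl | hl <;>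
      rcases (Nat.le_of_lt_succ hl').eq_or_lt with rfl | hl'
    · rfl
    · simp only [addLabel_label_numLabels, addLabel_label_of_lt hl'] at heq
      exact absurd heq.symm (hnew l' hl')
    · simp only [addLabel_label_numLabels, addLabel_label_of_lt hl] at heq
      exact absurd heq (hnew l hl)
    · simp only [addLabel_label_of_lt hl, addLabel_label_of_lt hl'] at heq
      exact hw.height_injOn hl hl' heq
  · exact (congrArg Prod.snd (hassign hkj hj)).trans (hw.color_assign j hkj hj)
  · change ((w.addLabel c).label (w.assign (I.order i))).1 ∉
      Set.uIcc (I.sortedY j) ((w.addLabel c).label (w.assign (I.order j))).1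
    rw [hassign (hkj.trans hji) hi, hassign hkj (hji.trans_lt hi)]
    exact hw.notMem_uIcc i j hkj hji hi hij

end IsValid

end Sweep

namespace Sweep

open ColoredPoints

variable {n m : ℕ} {I : ColoredPoints n m} {w : Sweep} {k l : ℕ} {b t : ℝ × ℕ}

/-- The labels placed so far can be extended to an optimal labeling that assigns the points
`k, …, n - 1` as they are assigned now. -/
structure IsExtendable (I : ColoredPoints n m) (w : Sweep) (k : ℕ) : Prop where
  isValid : w.IsValid I k
  total_eq : I.total k (w.backbones I) = I.minBetween n I.bottom I.top + 2

namespace IsValid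

theorem sortedY_mem_Ioo_of_adjacent (hw : w.IsValid I k) {j : ℕ} (hj : j < n)
    (h : Adjacent (w.backbones I) b t) (hY : I.sortedY j ∈ Set.Ioc b.1 t.1) :
    I.sortedY j ∈ Set.Ioo b.1 t.1 :=
  ⟨hY.1, hY.2.lt_of_ne (hw.fst_ne_sortedY h.right_mem j hj).symm⟩

theorem connect_of_adjacent (hw : w.IsValid I (k + 1)) (hk : k < n)
    (h : Adjacent (w.backbones I) b t) (hY : I.sortedY k ∈ Set.Ioc b.1 t.1)
    (hl : l < w.numLabels) (hcolor : (w.label l).2 = I.sortedColor k)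
    (hend : w.label l = b ∨ w.label l = t) :
    (w.connect (I.order k) l).IsValid I k := by
  refine hw.connect hk hl hcolor fun l' hl' hne hmem => hne (hw.height_injOn hl' hl ?_)
  refine h.fst_eq_of_mem_uIcc (hw.sortedY_mem_Ioo_of_adjacent hk h hY) ?_
    (label_mem_backbones hl') hmem
  rcases hend with hend | hend <;> simp only [hend]
  · exact Set.left_mem_Icc.2 h.lt.le
  · exact Set.right_mem_Icc.2 h.lt.le

theorem assign_lt_of_lt (hw : w.IsValid I 0) {i : ℕ} (hi : i < n) :
    w.assign i < w.numLabels := by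
  obtain ⟨k, hk, heq⟩ := exists_point_eq (I := I) ⟨i, hi⟩
  have heq : I.order k = i := congrArg Fin.val heq
  exact heq ▸ hw.assign_lt k k.zero_le hk

theorem of_numLabels_eq_zero (hw : w.numLabels = 0) : w.IsValid I n := by
  constructor <;> grind [Set.InjOn]

/-- The labeling given by a sweep that has reached the leftmost point. -/
def toLabeling (hw : w.IsValid I 0) : Labeling n m where
  numLabels := w.numLabels
  color l := ⟨(w.label l).2, hw.color_lt l l.2⟩
  y l := (w.label l).1
  assign i := ⟨w.assign i, hw.assign_lt_of_lt i.2⟩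

theorem isCrossingFree_toLabeling (hw : w.IsValid I 0) : I.IsCrossingFree hw.toLabeling := by
  refine isCrossingFree_of_notMem_uIcc (fun l => Set.Ioo_subset_Icc_self (hw.height_mem l l.2))
    (fun i => Fin.ext ?_) (fun l l' h => Fin.ext (hw.height_injOn l.2 l'.2 h))
    fun i j hij hne => ?_
  · obtain ⟨k, hk, rfl⟩ := exists_point_eq (I := I) i
    exact (hw.color_assign k k.zero_le hk).trans (colorAt_val (I.point hk))
  · obtain ⟨k, hk, rfl⟩ := exists_point_eq (I := I) i
    obtain ⟨k', hk', rfl⟩ := exists_point_eq (I := I) j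
    rw [← xAt_val, ← xAt_val] at hij
    have hle : k' ≤ k := not_lt.1 fun hlt => hij.not_gt (xAt_order_lt_xAt_order hlt hk')
    rw [← yAt_val]
    exact hw.notMem_uIcc k k' k'.zero_le hle hk fun h => hne (Fin.ext h)

end IsValid

namespace IsExtendable

theorem connect (hn : 0 < n) (hw : w.IsExtendable I (k + 1)) (hk : k < n)
    (h : Adjacent (w.backbones I) b t) (hY : I.sortedY k ∈ Set.Ioc b.1 t.1)
    (ho : IsOptimalDecision I.sortedRank I.sortedColor k (I.gap b.1, b.2) (I.gap t.1, t.2) none)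
    (hl : l < w.numLabels) (hcolor : (w.label l).2 = I.sortedColor k)
    (hend : w.label l = b ∨ w.label l = t) :
    (w.connect (I.order k) l).IsExtendable I k where
  isValid := hw.isValid.connect_of_adjacent hk h hY hl hcolor hend
  total_eq := (total_of_connect hk (hw.isValid.injOn_fst hn) h hY ho).trans hw.total_eq

theorem addLabel_connect (hn : 0 < n) (hw : w.IsExtendable I (k + 1)) (hk : k < n)
    (h : Adjacent (w.backbones I) b t) (hY : I.sortedY k ∈ Set.Ioc b.1 t.1) {g : ℕ} {y : ℝ}
    (ho : IsOptimalDecision I.sortedRank I.sortedColor k (I.gap b.1, b.2) (I.gap t.1, t.2)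
      (some g))
    (hy : y ∈ Set.Ioo b.1 t.1) (hlevel : y ∈ Set.Ioo (I.level g) (I.level (g + 1))) :
    ((w.addLabel (y, I.sortedColor k)).connect (I.order k) w.numLabels).IsExtendable I k := by
  have hgn : g ≤ n := ho.isAllowed.2.trans gap_le
  have hnew : ∀ l < w.numLabels, (w.label l).1 ≠ y := fun l hl heq =>
    h.notMem_Ioo _ (label_mem_backbones hl) (heq ▸ hy)
  have hmem : y ∈ Set.Ioo I.ymin I.ymax :=
    ⟨(hw.isValid.fst_mem_Icc hn h.left_mem).1.trans_lt hy.1,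
      hy.2.trans_le (hw.isValid.fst_mem_Icc hn h.right_mem).2⟩
  have hvalid := hw.isValid.addLabel (c := (y, I.sortedColor k)) hmem
    (ne_sortedY_of_mem_Ioo_level hn hgn hlevel) (sortedColor_lt hk) hnew
  refine ⟨?_, ?_⟩
  · have hIoo := hw.isValid.sortedY_mem_Ioo_of_adjacent hk h hY
    refine hvalid.connect hk (Nat.lt_succ_self _) ?_ fun l hl hne => ?_
    · rw [addLabel_label_numLabels]
    · have hl : l < w.numLabels := (Nat.le_of_lt_succ hl).lt_of_ne hne
      rw [addLabel_label_of_lt hl, addLabel_label_numLabels]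
      exact fun hmem => hnew l hl
        (h.fst_eq_of_mem_uIcc hIoo (Set.Ioo_subset_Icc_self hy) (label_mem_backbones hl) hmem)
  · rw [← gap_eq_of_mem_Ioo_level hn hgn hlevel] at ho
    refine (congrArg (I.total k) backbones_addLabel).trans ?_
    exact (total_insert hk (hw.isValid.injOn_fst hn) h hY hy ho).trans hw.total_eq

theorem of_numLabels_eq_zero (hn : 0 < n) (hw : w.numLabels = 0) : w.IsExtendable I n where
  isValid := .of_numLabels_eq_zero hw
  total_eq := by
    have hlt := ymin_lt_ymax (I := I) hn
    have hne : I.bottom ≠ I.top := fun h => hlt.ne (congrArg Prod.fst h)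
    have hpairs : adjacentPairs {I.bottom, I.top} = {(I.bottom, I.top)} := by
      ext p
      rw [mem_adjacentPairs, Finset.mem_singleton]
      constructor
      · rintro ⟨hb, ht, hbt, -⟩
        rw [Finset.mem_insert, Finset.mem_singleton] at hb ht
        rcases hb with hb | hb <;> rcases ht with ht | ht <;> rw [hb, ht] at hbt
        · exact absurd hbt (lt_irrefl _)
        · exact Prod.ext hb ht
        · exact absurd hbt hlt.not_gt
        · exact absurd hbt (lt_irrefl _)
      · rintro rfl
        refine ⟨by simp, by simp, hlt, fun c hc hmem => ?_⟩
        rw [Finset.mem_insert, Finset.mem_singleton] at hc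
        rcases hc with rfl | rfl
        · exact hmem.1.false
        · exact hmem.2.false
    have hbackbones : w.backbones I = {I.bottom, I.top} := by simp [backbones, hw]
    rw [total, hbackbones, hpairs, Finset.sum_singleton, Finset.card_pair hne, add_comm]

theorem numLabels_le (hn : 0 < n) (hw : w.IsExtendable I 0) :
    w.numLabels ≤ I.minBetween n I.bottom I.top := by
  have hlabels : #(((Finset.range w.numLabels).image w.label)) = w.numLabels := by
    rw [Finset.card_image_of_injOn, Finset.card_range]
    exact fun l hl l' hl' h => hw.isValid.height_injOn (Finset.mem_range.1 hl)
      (Finset.mem_range.1 hl') (congrArg Prod.fst h)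
  have hcard : w.numLabels + 2 ≤ #(w.backbones I) := by
    have hlt := ymin_lt_ymax (I := I) hn
    rw [backbones, Finset.card_insert_of_notMem, Finset.card_insert_of_notMem, hlabels]
    · simp only [Finset.mem_image, Finset.mem_range, not_exists, not_and]
      exact fun l hl h => (hw.isValid.height_mem l hl).2.ne (congrArg Prod.fst h)
    · simp only [Finset.mem_insert, Finset.mem_image, Finset.mem_range, not_or, not_exists, not_and]
      exact ⟨fun h => hlt.ne (congrArg Prod.fst h),
        fun l hl h => (hw.isValid.height_mem l hl).1.ne' (congrArg Prod.fst h)⟩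
  have htotal := hw.total_eq
  rw [total] at htotal
  omega

theorem isOptimal_toLabeling (hn : 0 < n) (hw : w.IsExtendable I 0) :
    I.IsOptimal hw.isValid.toLabeling :=
  ⟨hw.isValid.isCrossingFree_toLabeling, fun _ hL =>
    (hw.numLabels_le hn).trans (minBetween_bottom_top_le_numLabels hL)⟩

end IsExtendable

end Sweep

/-! ### Program logic with time bounds -/

namespace Prog

/-- The total cost of all instructions of a program, each counted once. -/
def time : Prog → ℕ
  | skip => 1
  | iset _ e => e.cost + 1
  | iwrite _ i e => i.cost + e.cost + 1
  | rset _ e => e.cost + 1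
  | rwrite _ i e => i.cost + e.cost + 1
  | seq p q => p.time + q.time
  | ite b p q => b.cost + (p.time + q.time) + 1
  | loop b p => b.cost + p.time + 1

/-- Weakest precondition of a loop-free program; it is `False` for loops, which are handled by
`Runs.forLoop`. -/
def wp (W : ℕ) : Prog → (State → Prop) → State → Prop
  | skip, Q, s => Q s
  | iset v e, Q, s => e.Fits W s ∧ Q (s.setI v (e.eval s))
  | iwrite a i e, Q, s => i.Fits W s ∧ e.Fits W s ∧ Q (s.writeI a (i.eval s) (e.eval s))
  | rset v e, Q, s => e.Fits W s ∧ Q (s.setR v (e.eval s))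
  | rwrite a i e, Q, s => i.Fits W s ∧ e.Fits W s ∧ Q (s.writeR a (i.eval s) (e.eval s))
  | seq p q, Q, s => p.wp W (q.wp W Q) s
  | ite b p q, Q, s => b.Fits W s ∧ (b.Holds s → p.wp W Q s) ∧ (¬ b.Holds s → q.wp W Q s)
  | loop _ _, _, _ => False

/-- Sequential composition of a list of programs. -/
def block : List Prog → Prog
  | [] => skip
  | [p] => p
  | p :: q :: l => seq p (block (q :: l))

/-- Execute `p` for the values `0, 1, …, e - 1` of integer variable `v`; the limit `e` is
evaluated anew in each round. -/
def forLoop (v : ℕ) (e : IExp) (p : Prog) : Prog :=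
  seq (iset v (.const 0)) (loop (.ilt (.var v) e) (seq p (iset v (.add (.var v) (.const 1)))))

end Prog

section StateLemmas

variable (s : State) (a b i v w x : ℕ) (z : ℝ)

namespace State

theorem setI_ivar : (s.setI v x).ivar w = if w = v then x else s.ivar w := by
  simp only [setI, Function.update_apply]

theorem setI_imem : (s.setI v x).imem = s.imem := rfl

theorem setI_rvar : (s.setI v x).rvar = s.rvar := rfl

theorem setI_rmem : (s.setI v x).rmem = s.rmem := rfl

theorem setR_ivar : (s.setR v z).ivar = s.ivar := rfl

theorem setR_imem : (s.setR v z).imem = s.imem := rfl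

theorem setR_rvar : (s.setR v z).rvar w = if w = v then z else s.rvar w := by
  simp only [setR, Function.update_apply]

theorem setR_rmem : (s.setR v z).rmem = s.rmem := rfl

theorem writeI_ivar : (s.writeI a i x).ivar = s.ivar := rfl

theorem writeI_imem :
    (s.writeI a i x).imem b = if b = a then Function.update (s.imem a) i x else s.imem b := by
  simp only [writeI, Function.update_apply]

theorem writeI_rvar : (s.writeI a i x).rvar = s.rvar := rfl

theorem writeI_rmem : (s.writeI a i x).rmem = s.rmem := rfl

theorem writeR_ivar : (s.writeR a i z).ivar = s.ivar := rfl

theorem writeR_imem : (s.writeR a i z).imem = s.imem := rfl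

theorem writeR_rvar : (s.writeR a i z).rvar = s.rvar := rfl

theorem writeR_rmem :
    (s.writeR a i z).rmem b = if b = a then Function.update (s.rmem a) i z else s.rmem b := by
  simp only [writeR, Function.update_apply]

end State

end StateLemmas

/-- Started in `s`, program `p` halts in a state satisfying `Q` within the time it takes to
execute each of its instructions `B + 1` times. The offset makes straight-line code run for
every `B`. -/
def Runs (W : ℕ) (p : Prog) (s : State) (B : ℕ) (Q : State → Prop) : Prop :=
  ∃ t s', Exec W p s t s' ∧ t ≤ p.time * (B + 1) ∧ Q s'

namespace Runs

variable {W B : ℕ} {p q : Prog} {s : State} {Q R : State → Prop}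

theorem mono {B' : ℕ} (h : Runs W p s B Q) (hB : B ≤ B') : Runs W p s B' Q := by
  obtain ⟨t, s', hexec, ht, hs'⟩ := h
  exact ⟨t, s', hexec, ht.trans (by gcongr), hs'⟩

theorem imp (h : Runs W p s B R) (hRQ : ∀ s', R s' → Q s') : Runs W p s B Q := by
  obtain ⟨t, s', hexec, ht, hs'⟩ := h
  exact ⟨t, s', hexec, ht, hRQ s' hs'⟩

theorem seq (hp : Runs W p s B R) (hq : ∀ s', R s' → Runs W q s' B Q) :
    Runs W (.seq p q) s B Q := by
  obtain ⟨t₁, s₁, hexec₁, ht₁, hs₁⟩ := hp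
  obtain ⟨t₂, s₂, hexec₂, ht₂, hs₂⟩ := hq s₁ hs₁
  exact ⟨_, s₂, .seq hexec₁ hexec₂, by rw [Prog.time, add_mul]; gcongr, hs₂⟩

theorem ite {b : Test} (hb : b.Fits W s) (hp : b.Holds s → Runs W p s B Q)
    (hq : ¬ b.Holds s → Runs W q s B Q) : Runs W (.ite b p q) s B Q := by
  by_cases h : b.Holds s
  · obtain ⟨t, s', hexec, ht, hs'⟩ := hp h
    exact ⟨_, s', .ite_true hb h hexec, by rw [Prog.time]; nlinarith, hs'⟩
  · obtain ⟨t, s', hexec, ht, hs'⟩ := hq h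
    exact ⟨_, s', .ite_false hb h hexec, by rw [Prog.time]; nlinarith, hs'⟩

theorem of_wp (h : p.wp W Q s) : Runs W p s B Q := by
  have le_mul (t : ℕ) : t ≤ t * (B + 1) := Nat.le_mul_of_pos_right t B.succ_pos
  induction p generalizing s Q with
  | skip => exact ⟨_, _, .skip s, le_mul _, h⟩
  | iset v e => exact ⟨_, _, .iset h.1, le_mul _, h.2⟩
  | iwrite a i e => exact ⟨_, _, .iwrite h.1 h.2.1, le_mul _, h.2.2⟩
  | rset v e => exact ⟨_, _, .rset h.1, le_mul _, h.2⟩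
  | rwrite a i e => exact ⟨_, _, .rwrite h.1 h.2.1, le_mul _, h.2.2⟩
  | seq p q ihp ihq => exact .seq (ihp h) fun s' h' => ihq h'
  | ite b p q ihp ihq => exact .ite h.1 (fun hb => ihp (h.2.1 hb)) fun hb => ihq (h.2.2 hb)
  | loop b p => exact h.elim

theorem loop {b : Test} (Inv : ℕ → State → Prop) (N : ℕ) (h0 : Inv 0 s)
    (hstep : ∀ j < N, ∀ s, Inv j s → b.Fits W s ∧ b.Holds s ∧ Runs W p s B (Inv (j + 1)))
    (hdone : ∀ s, Inv N s → b.Fits W s ∧ ¬ b.Holds s) :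
    Runs W (.loop b p) s (N * (B + 1)) (Inv N) := by
  have rounds (k j : ℕ) (s : State) (hj : j + k = N) (hs : Inv j s) : ∃ t s',
      Exec W (.loop b p) s t s' ∧ t ≤ k * (b.cost + p.time * (B + 1) + 1) + (b.cost + 1) ∧
        Inv N s' := by
    induction k generalizing j s with
    | zero =>
      obtain rfl : j = N := hj
      exact ⟨_, s, .loop_done (hdone s hs).1 (hdone s hs).2, by omega, hs⟩
    | succ k ih =>
      obtain ⟨hfits, hholds, t₁, s₁, hexec₁, ht₁, hs₁⟩ := hstep j (by omega) s hs
      obtain ⟨t₂, s₂, hexec₂, ht₂, hs₂⟩ := ih (j + 1) s₁ (by omega) hs₁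
      exact ⟨_, s₂, .loop_step hfits hholds hexec₁ hexec₂, by rw [Nat.succ_mul]; omega, hs₂⟩
  obtain ⟨t, s', hexec, ht, hs'⟩ := rounds N 0 s N.zero_add h0
  refine ⟨t, s', hexec, ht.trans ?_, hs'⟩
  calc N * (b.cost + p.time * (B + 1) + 1) + (b.cost + 1)
      ≤ N * (b.cost + p.time * (B + 1) + 1) + (b.cost + 1) +
          (N * (b.cost + 1) * B + p.time) := Nat.le_add_right _ _
    _ = (b.cost + p.time + 1) * (N * (B + 1) + 1) := by ring

theorem forLoop {v : ℕ} {e : IExp} (Inv : ℕ → State → Prop) {N : ℕ} (hN : N < W)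
    (h0 : Inv 0 (s.setI v 0))
    (hlimit : ∀ j s, Inv j s → e.Fits W s ∧ e.eval s = N)
    (hstep : ∀ j < N, ∀ s, Inv j s → s.ivar v = j →
      Runs W p s B fun s' => s'.ivar v = j ∧ Inv (j + 1) (s'.setI v (j + 1))) :
    Runs W (.forLoop v e p) s (N * (B + 1)) (Inv N) := by
  have init : (Prog.iset v (.const 0)).wp W (fun s => s.ivar v = 0 ∧ Inv 0 s) s :=
    ⟨(Nat.zero_le N).trans_lt hN, by simp [IExp.eval, State.setI_ivar, h0]⟩
  have test (j : ℕ) (s : State) (hj : j ≤ N) (h : s.ivar v = j ∧ Inv j s) :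
      (Test.ilt (.var v) e).Fits W s ∧ ((Test.ilt (.var v) e).Holds s ↔ j < N) := by
    simp only [Test.Fits, IExp.Fits, Test.Holds, IExp.eval, h.1, hlimit j s h.2, and_true, iff_self]
    omega
  have incr (j : ℕ) (s : State) (hj : j < N) (h : s.ivar v = j ∧ Inv (j + 1) (s.setI v (j + 1))) :
      (Prog.iset v (.add (.var v) (.const 1))).wp W (fun s => s.ivar v = j + 1 ∧ Inv (j + 1) s)
        s := by
    simp only [Prog.wp, IExp.Fits, IExp.eval, State.setI_ivar, h, if_true, and_true]
    omega
  exact .seq (.of_wp init) fun s hs => (loop (fun j s => s.ivar v = j ∧ Inv j s) N hs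
    (fun j hj s h => ⟨(test j s hj.le h).1, (test j s hj.le h).2.2 hj,
      .seq (hstep j hj s h.2 h.1) fun s' hs' => .of_wp (incr j s' hj hs')⟩)
    fun s h => ⟨(test N s le_rfl h).1, by simp [(test N s le_rfl h).2]⟩).imp fun _ h => h.2

end Runs

/-! ### Memory layout

The integer and real registers are numbered independently, and so are the arrays. -/

section Sorting

namespace Reg

@[simp] abbrev size : ℕ := 0
@[simp] abbrev numColors : ℕ := 1
@[simp] abbrev outer : ℕ := 2
@[simp] abbrev inner : ℕ := 3
@[simp] abbrev radix : ℕ := 4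
@[simp] abbrev numCodes : ℕ := 5
@[simp] abbrev xRank : ℕ := 6
@[simp] abbrev yRank : ℕ := 7
@[simp] abbrev bottom : ℕ := 8
@[simp] abbrev top : ℕ := 9
@[simp] abbrev rank : ℕ := 10
@[simp] abbrev bottomGap : ℕ := 11
@[simp] abbrev topGap : ℕ := 12
@[simp] abbrev color : ℕ := 13
@[simp] abbrev best : ℕ := 14
@[simp] abbrev decision : ℕ := 15
@[simp] abbrev candidate : ℕ := 16
@[simp] abbrev numLabels : ℕ := 17
@[simp] abbrev row : ℕ := 18
@[simp] abbrev bottomLabel : ℕ := 19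
@[simp] abbrev topLabel : ℕ := 20
@[simp] abbrev middle : ℕ := 21
@[simp] abbrev point : ℕ := 22

@[simp] abbrev ymin : ℕ := 2
@[simp] abbrev ymax : ℕ := 3
@[simp] abbrev pointY : ℕ := 4
@[simp] abbrev bottomY : ℕ := 5
@[simp] abbrev topY : ℕ := 6
@[simp] abbrev lowerBound : ℕ := 7
@[simp] abbrev upperBound : ℕ := 8
@[simp] abbrev labelY : ℕ := 9

end Reg

namespace Arr

@[simp] abbrev color : ℕ := 0
@[simp] abbrev assign : ℕ := 1
@[simp] abbrev labelColor : ℕ := 2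
@[simp] abbrev order : ℕ := 3
@[simp] abbrev sortedRank : ℕ := 4
@[simp] abbrev sortedColor : ℕ := 5
@[simp] abbrev value : ℕ := 6
@[simp] abbrev decision : ℕ := 7
@[simp] abbrev labelCode : ℕ := 8

@[simp] abbrev x : ℕ := 0
@[simp] abbrev y : ℕ := 1
@[simp] abbrev labelY : ℕ := 2
@[simp] abbrev level : ℕ := 3

end Arr

variable {n m W : ℕ} {I : ColoredPoints n m} {i j : ℕ} {s s' : State}

attribute [simp] State.setI_ivar State.setI_imem State.setI_rvar State.setI_rmem State.setR_ivar
  State.setR_imem State.setR_rvar State.setR_rmem State.writeI_ivar State.writeI_imem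
  State.writeI_rvar State.writeI_rmem State.writeR_ivar State.writeR_imem State.writeR_rvar
  State.writeR_rmem IExp.eval IExp.Fits RExp.eval RExp.Fits Test.Holds Test.Fits Prog.block Prog.wp

namespace Prog

/-- Increment integer variable `v` if `b` holds. -/
def incrIf (b : Test) (v : ℕ) : Prog := ite b (iset v (.add (.var v) (.const 1))) skip

open Classical in
@[simp]
theorem wp_incrIf {b : Test} {v : ℕ} {Q : State → Prop} (hv : s.ivar v + 1 < W) :
    (incrIf b v).wp W Q s ↔
      b.Fits W s ∧ Q (s.setI v (s.ivar v + if b.Holds s then 1 else 0)) := by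
  have hself : s.setI v (s.ivar v) = s := by simp [State.setI]
  have hfits : s.ivar v < W ∧ 1 < W := by omega
  by_cases hb : b.Holds s <;> simp [incrIf, hb, hself, hv, hfits]

end Prog

/-- The number of pairs of a gap between points and a color, where `m` stands for the colors of the
bottom and top sides of the rectangle. -/
def numCodes (n m : ℕ) : ℕ := (n + 1) * (m + 1)

/-- The memory holds the input and the constants derived from it. -/
structure HoldsInput (I : ColoredPoints n m) (s : State) : Prop where
  size : s.ivar Reg.size = n
  numColors : s.ivar Reg.numColors = m
  radix : s.ivar Reg.radix = m + 1
  numCodes : s.ivar Reg.numCodes = numCodes n m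
  ymin : s.rvar Reg.ymin = I.ymin
  ymax : s.rvar Reg.ymax = I.ymax
  color : s.imem Arr.color = I.colorAt
  x : s.rmem Arr.x = I.xAt
  y : s.rmem Arr.y = I.yAt

theorem HoldsInput.congr (h : HoldsInput I s)
    (hn : s'.ivar Reg.size = s.ivar Reg.size := by simp)
    (hm : s'.ivar Reg.numColors = s.ivar Reg.numColors := by simp)
    (hr : s'.ivar Reg.radix = s.ivar Reg.radix := by simp)
    (hc : s'.ivar Reg.numCodes = s.ivar Reg.numCodes := by simp)
    (hymin : s'.rvar Reg.ymin = s.rvar Reg.ymin := by simp)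
    (hymax : s'.rvar Reg.ymax = s.rvar Reg.ymax := by simp)
    (hcolor : s'.imem Arr.color = s.imem Arr.color := by simp)
    (hx : s'.rmem Arr.x = s.rmem Arr.x := by simp)
    (hy : s'.rmem Arr.y = s.rmem Arr.y := by simp) : HoldsInput I s' :=
  ⟨hn ▸ h.size, hm ▸ h.numColors, hr ▸ h.radix, hc ▸ h.numCodes, hymin ▸ h.ymin, hymax ▸ h.ymax,
    hcolor ▸ h.color, hx ▸ h.x, hy ▸ h.y⟩

/-- Words are large enough for all indices into the table of the dynamic program. -/
def IsWordBound (n m W : ℕ) : Prop :=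
  (n + 1) * numCodes n m * numCodes n m + 2 * n + m + 2 < W

theorem IsWordBound.add_lt (hW : IsWordBound n m W) : 2 * n + m + 2 < W := by
  unfold IsWordBound at hW
  omega

theorem numCodes_pos : 0 < numCodes n m := Nat.mul_pos n.succ_pos m.succ_pos

theorem IsWordBound.numCodes_lt (hW : IsWordBound n m W) : numCodes n m < W :=
  calc numCodes n m
      ≤ (n + 1) * numCodes n m * numCodes n m :=
        Nat.le_mul_of_pos_left _ (Nat.mul_pos n.succ_pos numCodes_pos)
    _ < W := by
        unfold IsWordBound at hW
        omega

theorem HoldsInput.size_fits_eval (hW : IsWordBound n m W) (h : HoldsInput I s) :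
    (IExp.var Reg.size).Fits W s ∧ (IExp.var Reg.size).eval s = n :=
  ⟨h.size.trans_lt (by have := hW.add_lt; omega), h.size⟩

/-! ### Sorting -/

section Rank

variable {α : Type*} {f : ℕ → ℝ} {v : ℕ → α} {a : ℕ → α}

theorem rank_succ : rank (j + 1) f i = rank j f i + if f j < f i then 1 else 0 := by
  simp only [rank, Finset.range_add_one, Finset.filter_insert]
  split_ifs <;> simp

theorem rank_le : rank j f i ≤ j := (Finset.card_filter_le _ _).trans_eq (Finset.card_range j)

/-- Array `a` holds the values `v j` of the indices `j < i` in the order of increasing keys `f j`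
among all `n` keys. -/
def HoldsSortedBy (n : ℕ) (f : ℕ → ℝ) (v : ℕ → α) (i : ℕ) (a : ℕ → α) : Prop :=
  ∀ r < n, nth n f r < i → a r = v (nth n f r)

theorem HoldsSortedBy.zero : HoldsSortedBy n f v 0 a := fun _ _ h => (Nat.not_lt_zero _ h).elim

theorem HoldsSortedBy.update (hf : Set.InjOn f (Set.Iio n)) (ha : HoldsSortedBy n f v i a)
    (hi : i < n) : HoldsSortedBy n f v (i + 1) (Function.update a (rank n f i) (v i)) := by
  intro r hr hlt
  rcases Nat.lt_succ_iff_lt_or_eq.1 hlt with hlt | rfl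
  · have hne : r ≠ rank n f i := by
      rintro rfl
      exact hlt.ne (nth_rank hf hi)
    rw [Function.update_of_ne hne, ha r hr hlt]
  · rw [rank_nth hf hr, Function.update_self]

end Rank

namespace Prog

/-- Set up the derived constants and the outermost levels. -/
def init : Prog := block [
  iset Reg.radix (.add (.var Reg.numColors) (.const 1)),
  iset Reg.numCodes (.mul (.add (.var Reg.size) (.const 1)) (.var Reg.radix)),
  rwrite Arr.level (.const 0) (.var Reg.ymin),
  rwrite Arr.level (.add (.var Reg.size) (.const 1)) (.var Reg.ymax)]

/-- Count point `inner` if it lies to the right of point `outer`, and if it lies below. -/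
def compare : Prog := block [
  incrIf (.rlt (.read Arr.x (.var Reg.outer)) (.read Arr.x (.var Reg.inner))) Reg.xRank,
  incrIf (.rlt (.read Arr.y (.var Reg.inner)) (.read Arr.y (.var Reg.outer))) Reg.yRank]

/-- Store point `outer` at its positions in the sorted arrays. -/
def place : Prog := block [
  iwrite Arr.order (.var Reg.xRank) (.var Reg.outer),
  iwrite Arr.sortedRank (.var Reg.xRank) (.var Reg.yRank),
  iwrite Arr.sortedColor (.var Reg.xRank) (.read Arr.color (.var Reg.outer)),
  rwrite Arr.level (.add (.var Reg.yRank) (.const 1)) (.read Arr.y (.var Reg.outer))]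

/-- Sort the points from right to left and their heights from bottom to top. -/
def sort : Prog :=
  forLoop Reg.outer (.var Reg.size) <| block [
    block [iset Reg.xRank (.const 0), iset Reg.yRank (.const 0)],
    forLoop Reg.inner (.var Reg.size) compare, place]

end Prog

/-- The invariant of `Prog.sort`: the points `0, …, i - 1` of the input are sorted. -/
structure SortInv (I : ColoredPoints n m) (i : ℕ) (s : State) : Prop where
  input : HoldsInput I s
  order : HoldsSortedBy n (fun i => -I.xAt i) id i (s.imem Arr.order)
  sortedRank : HoldsSortedBy n (fun i => -I.xAt i) (rank n I.yAt) i (s.imem Arr.sortedRank)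
  sortedColor : HoldsSortedBy n (fun i => -I.xAt i) I.colorAt i (s.imem Arr.sortedColor)
  level_zero : s.rmem Arr.level 0 = I.ymin
  level_succ : HoldsSortedBy n I.yAt I.yAt i fun r => s.rmem Arr.level (r + 1)
  level_last : s.rmem Arr.level (n + 1) = I.ymax
  value : s.imem Arr.value = fun _ => 0

theorem SortInv.congr (h : SortInv I i s) (input : HoldsInput I s')
    (himem : s'.imem = s.imem := by simp) (hrmem : s'.rmem = s.rmem := by simp) :
    SortInv I i s' :=
  ⟨input, himem ▸ h.order, himem ▸ h.sortedRank, himem ▸ h.sortedColor, hrmem ▸ h.level_zero,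
    hrmem ▸ h.level_succ, hrmem ▸ h.level_last, himem ▸ h.value⟩

/-- The invariant of the inner loop of `Prog.sort`: point `i` is compared with `0, …, j - 1`. -/
structure CompareInv (I : ColoredPoints n m) (i j : ℕ) (s : State) : Prop where
  sorted : SortInv I i s
  outer : s.ivar Reg.outer = i
  xRank : s.ivar Reg.xRank = rank j (fun i => -I.xAt i) i
  yRank : s.ivar Reg.yRank = rank j I.yAt i

/-- The memory holds the input, sorted. -/
structure HoldsSorted (I : ColoredPoints n m) (s : State) : Prop where
  input : HoldsInput I s
  order : ∀ k < n, s.imem Arr.order k = I.order k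
  sortedRank : ∀ k < n, s.imem Arr.sortedRank k = I.sortedRank k
  sortedColor : ∀ k < n, s.imem Arr.sortedColor k = I.sortedColor k
  level : ∀ g ≤ n + 1, s.rmem Arr.level g = I.level g

theorem SortInv.holdsSorted (h : SortInv I n s) : HoldsSorted I s where
  input := h.input
  order k hk := h.order k hk (nth_lt ColoredPoints.injOn_neg_xAt hk)
  sortedRank k hk := h.sortedRank k hk (nth_lt ColoredPoints.injOn_neg_xAt hk)
  sortedColor k hk := h.sortedColor k hk (nth_lt ColoredPoints.injOn_neg_xAt hk)
  level g hg := by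
    rcases g with _ | r
    · exact h.level_zero
    rcases hg.lt_or_eq with hlt | heq
    · have hr : r < n := by omega
      have hlt' := nth_lt (ColoredPoints.injOn_yAt (I := I)) hr
      exact (h.level_succ r hr hlt').trans (by
        rw [← ColoredPoints.level_succ_rank hlt', rank_nth ColoredPoints.injOn_yAt hr])
    · rw [heq, h.level_last, ColoredPoints.level_last]

theorem runs_init (hW : IsWordBound n m W) : Runs W .init (inputState I) 0 (SortInv I 0) := by
  have hadd := hW.add_lt
  have hfits : n < W ∧ m < W ∧ n + 1 < W ∧ m + 1 < W ∧ 1 < W := by omega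
  have hcodes : (n + 1) * (m + 1) < W := hW.numCodes_lt
  have post : SortInv I 0 (((((inputState I).setI Reg.radix (m + 1)).setI Reg.numCodes
      (numCodes n m)).writeR Arr.level 0 I.ymin).writeR Arr.level (n + 1) I.ymax) :=
    { input := by constructor <;> simp [inputState] <;> rfl
      order := .zero
      sortedRank := .zero
      sortedColor := .zero
      level_zero := by simp
      level_succ := .zero
      level_last := by simp
      value := rfl }
  refine .of_wp ?_
  simpa [Prog.init, inputState, numCodes, hfits, hfits.2.1.pos, hcodes] using post

theorem CompareInv.step (hW : IsWordBound n m W) (hi : i < n) (hj : j < n)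
    (h : CompareInv I i j s) (hinner : s.ivar Reg.inner = j) :
    Prog.compare.wp W
      (fun s' => s'.ivar Reg.inner = j ∧ CompareInv I i (j + 1) (s'.setI Reg.inner (j + 1))) s := by
  have hadd := hW.add_lt
  have hx : rank j (fun i => -I.xAt i) i ≤ j := rank_le
  have hy : rank j I.yAt i ≤ j := rank_le
  have hfits : i < W ∧ j < W ∧ rank j (fun i => -I.xAt i) i + 1 < W ∧ rank j I.yAt i + 1 < W := by
    omega
  have post : CompareInv I i (j + 1) (((s.setI Reg.xRank (rank (j + 1) (fun i => -I.xAt i) i)).setI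
      Reg.yRank (rank (j + 1) I.yAt i)).setI Reg.inner (j + 1)) :=
    { sorted := h.sorted.congr h.sorted.input.congr
      outer := by simp [h.outer]
      xRank := by simp
      yRank := by simp }
  simpa [Prog.compare, rank_succ, hfits, hinner, h.outer, h.xRank, h.yRank, h.sorted.input.x,
    h.sorted.input.y] using post

theorem CompareInv.place (hW : IsWordBound n m W) (hi : i < n) (h : CompareInv I i n s) :
    Prog.place.wp W
      (fun s' => s'.ivar Reg.outer = i ∧ SortInv I (i + 1) (s'.setI Reg.outer (i + 1))) s := by
  have hadd := hW.add_lt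
  have hx : rank n (fun i => -I.xAt i) i < n := rank_lt hi
  have hy : rank n I.yAt i < n := rank_lt hi
  have hfits : i < W ∧ rank n (fun i => -I.xAt i) i < W ∧ rank n I.yAt i < W ∧
      rank n I.yAt i + 1 < W ∧ 1 < W := by omega
  have hcolor : I.colorAt i < W := by
    simp only [ColoredPoints.colorAt, hi, dif_pos]
    omega
  have post : SortInv I (i + 1) (((((s.writeI Arr.order (rank n (fun i => -I.xAt i) i) i).writeI
      Arr.sortedRank (rank n (fun i => -I.xAt i) i) (rank n I.yAt i)).writeI
      Arr.sortedColor (rank n (fun i => -I.xAt i) i) (I.colorAt i)).writeR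
      Arr.level (rank n I.yAt i + 1) (I.yAt i)).setI Reg.outer (i + 1)) :=
    { input := h.sorted.input.congr
      order := by simpa using h.sorted.order.update ColoredPoints.injOn_neg_xAt hi
      sortedRank := by simpa using h.sorted.sortedRank.update ColoredPoints.injOn_neg_xAt hi
      sortedColor := by simpa using h.sorted.sortedColor.update ColoredPoints.injOn_neg_xAt hi
      level_zero := by simp [h.sorted.level_zero]
      level_succ := by
        convert h.sorted.level_succ.update ColoredPoints.injOn_yAt hi using 1
        ext r
        simp [Function.update_apply]
      level_last := by simp [h.sorted.level_last, hy.ne']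
      value := by simp [h.sorted.value] }
  simpa [Prog.place, hfits, hcolor, h.outer, h.xRank, h.yRank, h.sorted.input.color,
    h.sorted.input.y] using post

theorem runs_sort (hW : IsWordBound n m W) (h : SortInv I 0 s) :
    Runs W .sort s (n * (n + 1)) (SortInv I n) := by
  have hn : n < W := by have := hW.add_lt; omega
  refine .forLoop (SortInv I) hn (h.congr h.input.congr)
    (fun _ _ h => h.input.size_fits_eval hW) fun i hi s h hs => ?_
  have start : CompareInv I i 0 (((s.setI Reg.xRank 0).setI Reg.yRank 0).setI Reg.inner 0) :=
    { sorted := h.congr h.input.congr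
      outer := by simp [hs]
      xRank := by simp [rank]
      yRank := by simp [rank] }
  refine .seq (R := fun s => CompareInv I i 0 (s.setI Reg.inner 0)) (.of_wp ?_) fun s h => ?_
  · simpa [hn.pos] using start
  refine .seq (R := CompareInv I i n) ((Runs.forLoop (CompareInv I i) (B := 0) hn h
    (fun _ _ h => h.sorted.input.size_fits_eval hW) fun j hj s h hs => ?_).mono (by simp))
    fun s h => .of_wp (h.place hW hi)
  exact .of_wp (h.step hW hi hj hs)

end Sorting

section Table

variable {n m W : ℕ} {I : ColoredPoints n m} {s s' : State}

/-! ### Table indices -/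

/-- A pair of a gap and a color as a number below `numCodes n m`. -/
def encode (m : ℕ) (b : ℕ × ℕ) : ℕ := b.1 * (m + 1) + b.2

/-- The inverse of `encode`. -/
def decode (m b : ℕ) : ℕ × ℕ := (b / (m + 1), b % (m + 1))

/-- The position of the entry for the `k` rightmost points and the backbones with codes `b` and `t`
in the table of the dynamic program, where `N` is the number of codes. -/
def tableIndex (N k b t : ℕ) : ℕ := (k * N + b) * N + t

section TableIndex

variable {N K k k' b b' t t' e : ℕ}

theorem mul_add_div_of_lt (hb : b < N) : (k * N + b) / N = k := by
  rw [Nat.add_comm, Nat.add_mul_div_right _ _ (by omega), Nat.div_eq_of_lt hb, zero_add]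

theorem mul_add_lt_mul (hk : k < K) (hb : b < N) : k * N + b < K * N :=
  calc k * N + b < k * N + N := by omega
    _ = (k + 1) * N := (Nat.succ_mul k N).symm
    _ ≤ K * N := Nat.mul_le_mul_right N hk

theorem decode_encode {b : ℕ × ℕ} (hb : b.2 ≤ m) : decode m (encode m b) = b :=
  Prod.ext (mul_add_div_of_lt (Nat.lt_succ_of_le hb)) (Nat.mul_add_mod_of_lt (Nat.lt_succ_of_le hb))

theorem encode_lt {b : ℕ × ℕ} (hb₁ : b.1 ≤ n) (hb₂ : b.2 ≤ m) : encode m b < numCodes n m :=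
  mul_add_lt_mul (Nat.lt_succ_of_le hb₁) (Nat.lt_succ_of_le hb₂)

theorem decode_fst_le (hb : b < numCodes n m) : (decode m b).1 ≤ n :=
  Nat.le_of_lt_succ (Nat.div_lt_of_lt_mul (by rwa [Nat.mul_comm]))

theorem tableIndex_lt (hk : k < K) (hb : b < N) (ht : t < N) : tableIndex N k b t < K * N * N :=
  mul_add_lt_mul (mul_add_lt_mul hk hb) ht

theorem tableIndex_lt_add (hb' : b' < N) (ht' : t' < N) :
    tableIndex N k b' t' < tableIndex N k b t + N * N :=
  calc tableIndex N k b' t' < (k + 1) * N * N := tableIndex_lt k.lt_succ_self hb' ht'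
    _ = k * N * N + N * N := by ring
    _ ≤ tableIndex N k b t + N * N := by
      gcongr
      exact (Nat.mul_le_mul_right N (Nat.le_add_right _ b)).trans (Nat.le_add_right _ t)

theorem tableIndex_succ : tableIndex N (k + 1) b t = tableIndex N k b t + N * N := by
  unfold tableIndex
  ring

theorem tableIndex_mod (ht : t < N) : tableIndex N k b t % N = t := Nat.mul_add_mod_of_lt ht

theorem tableIndex_div_mod (hb : b < N) (ht : t < N) : tableIndex N k b t / N % N = b := by
  rw [tableIndex, mul_add_div_of_lt ht, Nat.mul_add_mod_of_lt hb]

theorem tableIndex_div_div (hb : b < N) (ht : t < N) : tableIndex N k b t / N / N = k := by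
  rw [tableIndex, mul_add_div_of_lt ht, mul_add_div_of_lt hb]

theorem tableIndex_inj (hb : b < N) (hb' : b' < N) (ht : t < N) (ht' : t' < N)
    (h : tableIndex N k b t = tableIndex N k' b' t') : k = k' ∧ b = b' ∧ t = t' :=
  ⟨by rw [← tableIndex_div_div (k := k) hb ht, h, tableIndex_div_div hb' ht'],
    by rw [← tableIndex_div_mod (k := k) hb ht, h, tableIndex_div_mod hb' ht'],
    by rw [← tableIndex_mod (k := k) (b := b) ht, h, tableIndex_mod ht']⟩

theorem exists_eq_tableIndex (hN : 0 < N) (he : e < K * N * N) :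
    ∃ k < K, ∃ b < N, ∃ t < N, e = tableIndex N k b t :=
  ⟨e / N / N, Nat.div_lt_of_lt_mul (Nat.div_lt_of_lt_mul (by rwa [Nat.mul_comm, Nat.mul_comm N])),
    e / N % N, Nat.mod_lt _ hN, e % N, Nat.mod_lt _ hN,
    by rw [tableIndex, Nat.div_add_mod', Nat.div_add_mod']⟩

end TableIndex

/-! ### Filling the table -/

/-- The decision that is stored as a number. -/
def decodeDecision : ℕ → Option ℕ
  | 0 => none
  | g + 1 => some g

namespace Prog

/-- The table position of the entry given by the registers `k`, `b` and `t`. -/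
def indexExp (k b t : ℕ) : IExp :=
  .add (.mul (.add (.mul (.var k) (.var Reg.numCodes)) (.var b)) (.var Reg.numCodes)) (.var t)

/-- Load the parameters of table entry `outer`. -/
def decodeCell : Prog := block [
  iset Reg.row (.div (.div (.var Reg.outer) (.var Reg.numCodes)) (.var Reg.numCodes)),
  iset Reg.bottom (.mod (.div (.var Reg.outer) (.var Reg.numCodes)) (.var Reg.numCodes)),
  iset Reg.top (.mod (.var Reg.outer) (.var Reg.numCodes)),
  iset Reg.rank (.read Arr.sortedRank (.var Reg.row)),
  iset Reg.color (.read Arr.sortedColor (.var Reg.row)),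
  iset Reg.bottomGap (.div (.var Reg.bottom) (.var Reg.radix)),
  iset Reg.topGap (.div (.var Reg.top) (.var Reg.radix))]

/-- The cost of a new backbone with code `middle`. -/
def splitCost : IExp :=
  .add (.add (.read Arr.value (indexExp Reg.row Reg.bottom Reg.middle))
    (.read Arr.value (indexExp Reg.row Reg.middle Reg.top))) (.const 1)

/-- Compute the cost of a new backbone in gap `bottomGap + inner`. -/
def evaluateSplit : Prog := block [
  iset Reg.middle (.add (.mul (.add (.var Reg.bottomGap) (.var Reg.inner)) (.var Reg.radix))
    (.var Reg.color)),
  iset Reg.candidate splitCost]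

/-- Take the lowest gap as first candidate. -/
def initSearch : Prog := block [
  iset Reg.inner (.const 0), evaluateSplit,
  iset Reg.best (.var Reg.candidate),
  iset Reg.decision (.add (.var Reg.bottomGap) (.const 1))]

/-- Compare the best decision with a new backbone in gap `bottomGap + inner`. -/
def improve : Prog :=
  seq evaluateSplit <| ite (.ilt (.var Reg.candidate) (.var Reg.best))
    (block [iset Reg.best (.var Reg.candidate),
      iset Reg.decision (.add (.add (.var Reg.bottomGap) (.var Reg.inner)) (.const 1))])
    skip

/-- Take the value of the previous row, at no cost. -/
def copy : Prog := block [
  iset Reg.best (.read Arr.value (.var Reg.outer)), iset Reg.decision (.const 0)]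

/-- Compare the best decision with connecting the point to one of the two backbones. -/
def tryConnect : Prog :=
  ite (.and (.or (.ieq (.var Reg.color) (.mod (.var Reg.bottom) (.var Reg.radix)))
      (.ieq (.var Reg.color) (.mod (.var Reg.top) (.var Reg.radix))))
      (.ilt (.read Arr.value (.var Reg.outer)) (.var Reg.best)))
    copy skip

/-- Find the best decision for a point between the two backbones. -/
def search : Prog := block [
  initSearch,
  forLoop Reg.inner (.sub (.add (.var Reg.topGap) (.const 1)) (.var Reg.bottomGap)) improve,
  tryConnect]

/-- Compute a table entry. -/
def cell : Prog :=
  ite (.and (.not (.ilt (.var Reg.rank) (.var Reg.bottomGap)))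
    (.ilt (.var Reg.rank) (.var Reg.topGap))) search copy

/-- Store a table entry, in the row that follows that of `outer`, and the decision. -/
def store : Prog := block [
  iwrite Arr.value (.add (.var Reg.outer) (.mul (.var Reg.numCodes) (.var Reg.numCodes)))
    (.var Reg.best),
  iwrite Arr.decision (.var Reg.outer) (.var Reg.decision)]

/-- Fill the table of the dynamic program row by row. -/
def table : Prog :=
  forLoop Reg.outer (.mul (.mul (.var Reg.size) (.var Reg.numCodes)) (.var Reg.numCodes)) <|
    block [decodeCell, cell, store]

end Prog

theorem HoldsSorted.congr (h : HoldsSorted I s) (input : HoldsInput I s')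
    (horder : s'.imem Arr.order = s.imem Arr.order := by simp)
    (hrank : s'.imem Arr.sortedRank = s.imem Arr.sortedRank := by simp)
    (hcolor : s'.imem Arr.sortedColor = s.imem Arr.sortedColor := by simp)
    (hlevel : s'.rmem Arr.level = s.rmem Arr.level := by simp) : HoldsSorted I s' :=
  ⟨input, horder ▸ h.order, hrank ▸ h.sortedRank, hcolor ▸ h.sortedColor, hlevel ▸ h.level⟩

/-- The first `e` entries of the array `a` are optimal decisions, where they concern a point between
the two backbones. -/
def HoldsDecisions (I : ColoredPoints n m) (e : ℕ) (a : ℕ → ℕ) : Prop :=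
  ∀ k, ∀ b < numCodes n m, ∀ t < numCodes n m, tableIndex (numCodes n m) k b t < e →
    (decode m b).1 ≤ I.sortedRank k → I.sortedRank k < (decode m t).1 →
      a (tableIndex (numCodes n m) k b t) ≤ n + 1 ∧
      IsOptimalDecision I.sortedRank I.sortedColor k (decode m b) (decode m t)
        (decodeDecision (a (tableIndex (numCodes n m) k b t)))

/-- The first `e` entries of the table from row `1` on are filled. -/
structure TableInv (I : ColoredPoints n m) (e : ℕ) (s : State) : Prop where
  sorted : HoldsSorted I s
  value : ∀ k, ∀ b < numCodes n m, ∀ t < numCodes n m,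
    tableIndex (numCodes n m) k b t < e + numCodes n m * numCodes n m →
      s.imem Arr.value (tableIndex (numCodes n m) k b t) =
        minBackbones I.sortedRank I.sortedColor k (decode m b) (decode m t)
  decision : HoldsDecisions I e (s.imem Arr.decision)

theorem TableInv.congr {e : ℕ} (h : TableInv I e s) (input : HoldsInput I s')
    (himem : s'.imem = s.imem := by simp) (hrmem : s'.rmem = s.rmem := by simp) :
    TableInv I e s' :=
  ⟨h.sorted.congr input (by simp [himem]) (by simp [himem]) (by simp [himem]) (by simp [hrmem]),
    himem ▸ h.value, himem ▸ h.decision⟩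

/-- The parameters of the table entry for `k`, `b` and `t` are loaded. -/
structure CellInv (I : ColoredPoints n m) (k b t : ℕ) (s : State) : Prop where
  row_lt : k < n
  bottom_lt : b < numCodes n m
  top_lt : t < numCodes n m
  table : TableInv I (tableIndex (numCodes n m) k b t) s
  outer : s.ivar Reg.outer = tableIndex (numCodes n m) k b t
  row : s.ivar Reg.row = k
  bottom : s.ivar Reg.bottom = b
  top : s.ivar Reg.top = t
  rank : s.ivar Reg.rank = I.sortedRank k
  color : s.ivar Reg.color = I.sortedColor k
  bottomGap : s.ivar Reg.bottomGap = (decode m b).1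
  topGap : s.ivar Reg.topGap = (decode m t).1

/-- The cost of decision `o` in the table entry for `k`, `b` and `t`. -/
noncomputable abbrev ColoredPoints.cellCost (I : ColoredPoints n m) (k b t : ℕ)
    (o : Option ℕ) : ℕ :=
  decisionCost (minBackbones I.sortedRank I.sortedColor k) (I.sortedColor k) (decode m b)
    (decode m t) o

/-- The best decision is found for the table entry for `k`, `b` and `t`. -/
structure CellResult (I : ColoredPoints n m) (k b t : ℕ) (s : State) : Prop where
  cell : CellInv I k b t s
  best : s.ivar Reg.best =
    minBackbones I.sortedRank I.sortedColor (k + 1) (decode m b) (decode m t)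
  decision_le : s.ivar Reg.decision ≤ n + 1
  isOptimalDecision : (decode m b).1 ≤ I.sortedRank k → I.sortedRank k < (decode m t).1 →
    IsOptimalDecision I.sortedRank I.sortedColor k (decode m b) (decode m t)
      (decodeDecision (s.ivar Reg.decision))

/-- The stored decision is allowed and at least as good as each of the `j` lowest new backbones. -/
structure SearchInv (I : ColoredPoints n m) (k b t j : ℕ) (s : State) : Prop where
  cell : CellInv I k b t s
  decision_le : s.ivar Reg.decision ≤ n + 1
  isAllowed : IsAllowed (I.sortedColor k) (decode m b) (decode m t)
    (decodeDecision (s.ivar Reg.decision))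
  best : s.ivar Reg.best = I.cellCost k b t (decodeDecision (s.ivar Reg.decision))
  best_le : ∀ g, (decode m b).1 ≤ g → g < (decode m b).1 + j →
    s.ivar Reg.best ≤ I.cellCost k b t (some g)

theorem indexExp_fits_eval (hW : IsWordBound n m W) (h : HoldsInput I s) {k b t : ℕ}
    (hk : s.ivar k ≤ n) (hb : s.ivar b < numCodes n m) (ht : s.ivar t < numCodes n m) :
    (Prog.indexExp k b t).Fits W s ∧ (Prog.indexExp k b t).eval s =
      tableIndex (numCodes n m) (s.ivar k) (s.ivar b) (s.ivar t) := by
  have hadd := hW.add_lt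
  have hN := hW.numCodes_lt
  have h₁ : s.ivar k * numCodes n m + s.ivar b < (n + 1) * numCodes n m :=
    mul_add_lt_mul (Nat.lt_succ_of_le hk) hb
  have h₂ := mul_add_lt_mul h₁ ht
  have h₃ := Nat.le_mul_of_pos_right ((n + 1) * numCodes n m) (numCodes_pos (n := n) (m := m))
  unfold IsWordBound at hW
  simp [Prog.indexExp, h.numCodes, tableIndex]
  omega

section Cell

variable {k b t j x v : ℕ}

theorem CellInv.setI (h : CellInv I k b t s)
    (hv : v ∈ [Reg.inner, Reg.middle, Reg.candidate, Reg.best, Reg.decision]) :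
    CellInv I k b t (s.setI v x) := by
  obtain ⟨hk, hb, ht, htable, houter, hrow, hbottom, htop, hrank, hcolor, hbottomGap, htopGap⟩ := h
  simp only [List.mem_cons, List.not_mem_nil, or_false] at hv
  rcases hv with rfl | rfl | rfl | rfl | rfl <;>
    exact ⟨hk, hb, ht, htable.congr htable.sorted.input.congr, by simpa, by simpa, by simpa,
      by simpa, by simpa, by simpa, by simpa, by simpa⟩

theorem cellCost_le {o : Option ℕ} : I.cellCost k b t o ≤ 2 * k + 1 := by
  have hle (b t : ℕ × ℕ) : minBackbones I.sortedRank I.sortedColor k b t ≤ k := minBackbones_le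
  rcases o with _ | g
  · exact (hle _ _).trans (by omega)
  · have h₁ := hle (decode m b) (g, I.sortedColor k)
    have h₂ := hle (g, I.sortedColor k) (decode m t)
    simp only [decisionCost]
    omega

theorem CellInv.splitCost_fits_eval (hW : IsWordBound n m W) (h : CellInv I k b t s) {g : ℕ}
    (hg : g ≤ (decode m t).1) (hmiddle : s.ivar Reg.middle = encode m (g, I.sortedColor k)) :
    Prog.splitCost.Fits W s ∧ Prog.splitCost.eval s = I.cellCost k b t (some g) := by
  have hadd := hW.add_lt
  have hk := h.row_lt
  have hcolor := (ColoredPoints.sortedColor_lt (I := I) hk).le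
  have hlt : encode m (g, I.sortedColor k) < numCodes n m :=
    encode_lt (hg.trans (decode_fst_le h.top_lt)) hcolor
  have hlower := h.table.value k b h.bottom_lt _ hlt (tableIndex_lt_add h.bottom_lt hlt)
  have hupper := h.table.value k _ hlt t h.top_lt (tableIndex_lt_add hlt h.top_lt)
  rw [decode_encode hcolor] at hlower hupper
  have index₁ := indexExp_fits_eval hW h.table.sorted.input (k := Reg.row) (b := Reg.bottom)
    (t := Reg.middle) (h.row.trans_le hk.le) (h.bottom.trans_lt h.bottom_lt) (hmiddle.trans_lt hlt)
  have index₂ := indexExp_fits_eval hW h.table.sorted.input (k := Reg.row) (b := Reg.middle)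
    (t := Reg.top) (h.row.trans_le hk.le) (hmiddle.trans_lt hlt) (h.top.trans_lt h.top_lt)
  rw [h.row, h.bottom, hmiddle] at index₁
  rw [h.row, h.top, hmiddle] at index₂
  have hcost := cellCost_le (I := I) (k := k) (b := b) (t := t) (o := some g)
  simp only [decisionCost] at hcost
  simp [Prog.splitCost, index₁, index₂, hlower, hupper, decisionCost]
  omega

theorem CellInv.evaluateSplit (hW : IsWordBound n m W) (h : CellInv I k b t s)
    (hinner : s.ivar Reg.inner = j) (hj : (decode m b).1 + j ≤ (decode m t).1) {Q : State → Prop}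
    (hQ : Q ((s.setI Reg.middle (encode m ((decode m b).1 + j, I.sortedColor k))).setI Reg.candidate
      (I.cellCost k b t (some ((decode m b).1 + j))))) :
    Prog.evaluateSplit.wp W Q s := by
  have hadd := hW.add_lt
  have htop := decode_fst_le h.top_lt
  have hcolor := (ColoredPoints.sortedColor_lt (I := I) h.row_lt).le
  have hcode : ((decode m b).1 + j) * (m + 1) + I.sortedColor k < W :=
    (encode_lt (b := ((decode m b).1 + j, I.sortedColor k)) (hj.trans htop) hcolor).trans
      hW.numCodes_lt
  obtain ⟨hfits, heval⟩ := (h.setI (v := Reg.middle)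
    (x := encode m ((decode m b).1 + j, I.sortedColor k)) (by simp)).splitCost_fits_eval hW hj
    (by simp)
  simp only [encode] at hfits heval hQ
  simp [Prog.evaluateSplit, h.bottomGap, hinner, h.color, h.table.sorted.input.radix, hfits, heval,
    hQ]
  omega

theorem CellInv.initSearch (hW : IsWordBound n m W) (h : CellInv I k b t s)
    (hle : (decode m b).1 ≤ (decode m t).1) :
    Prog.initSearch.wp W (fun s => SearchInv I k b t 0 (s.setI Reg.inner 0)) s := by
  have hadd := hW.add_lt
  have htop := decode_fst_le h.top_lt
  have hcost := cellCost_le (I := I) (k := k) (b := b) (t := t) (o := some (decode m b).1)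
  have hk := h.row_lt
  have hfits : I.cellCost k b t (some (decode m b).1) < W ∧ (decode m b).1 < W ∧ 1 < W ∧
      (decode m b).1 + 1 < W := by omega
  refine ⟨(Nat.zero_le _).trans_lt hadd,
    (h.setI (by simp)).evaluateSplit hW (j := 0) (by simp) hle ?_⟩
  rw [Nat.add_zero]
  have post : SearchInv I k b t 0 ((((((s.setI Reg.inner 0).setI Reg.middle
      (encode m ((decode m b).1, I.sortedColor k))).setI Reg.candidate
      (I.cellCost k b t (some (decode m b).1))).setI Reg.best
      (I.cellCost k b t (some (decode m b).1))).setI Reg.decision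
      ((decode m b).1 + 1)).setI Reg.inner 0) :=
    { cell := ((((((h.setI (by simp)).setI (by simp)).setI (by simp)).setI (by simp)).setI
        (by simp)).setI (by simp))
      decision_le := by simpa using hle.trans htop
      isAllowed := by simpa [decodeDecision] using ⟨le_rfl, hle⟩
      best := by simp [decodeDecision]
      best_le := by
        intro g hg hlt
        omega }
  simpa [h.bottomGap, hfits] using post

theorem SearchInv.setI (h : SearchInv I k b t j s)
    (hv : v ∈ [Reg.inner, Reg.middle, Reg.candidate]) : SearchInv I k b t j (s.setI v x) := by
  have cell : CellInv I k b t (s.setI v x) := h.cell.setI <| by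
    simp only [List.mem_cons] at hv ⊢
    tauto
  obtain ⟨-, hle, hallowed, hbest, hbest_le⟩ := h
  simp only [List.mem_cons, List.not_mem_nil, or_false] at hv
  rcases hv with rfl | rfl | rfl <;>
    exact ⟨cell, by simpa, by simpa, by simpa, by simpa⟩

theorem SearchInv.succ (h : SearchInv I k b t j s)
    (hle : s.ivar Reg.best ≤ I.cellCost k b t (some ((decode m b).1 + j))) :
    SearchInv I k b t (j + 1) s where
  cell := h.cell
  decision_le := h.decision_le
  isAllowed := h.isAllowed
  best := h.best
  best_le g hg hlt := by
    rcases Nat.lt_succ_iff_lt_or_eq.1 hlt with hlt | rfl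
    · exact h.best_le g hg hlt
    · exact hle

theorem SearchInv.replace (h : SearchInv I k b t j s) (hj : (decode m b).1 + j ≤ (decode m t).1)
    (hlt : I.cellCost k b t (some ((decode m b).1 + j)) < s.ivar Reg.best) :
    SearchInv I k b t (j + 1) ((s.setI Reg.best
      (I.cellCost k b t (some ((decode m b).1 + j)))).setI Reg.decision
      ((decode m b).1 + j + 1)) where
  cell := (h.cell.setI (by simp)).setI (by simp)
  decision_le := by simpa using hj.trans (decode_fst_le h.cell.top_lt)
  isAllowed := by simpa [decodeDecision] using ⟨Nat.le_add_right _ _, hj⟩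
  best := by simp [decodeDecision]
  best_le g hg hlt' := by
    rcases Nat.lt_succ_iff_lt_or_eq.1 hlt' with hlt' | rfl
    · simpa using hlt.le.trans (h.best_le g hg hlt')
    · simp

theorem SearchInv.improve (hW : IsWordBound n m W) (h : SearchInv I k b t j s)
    (hinner : s.ivar Reg.inner = j) (hj : (decode m b).1 + j ≤ (decode m t).1) :
    Prog.improve.wp W
      (fun s => s.ivar Reg.inner = j ∧ SearchInv I k b t (j + 1) (s.setI Reg.inner (j + 1))) s := by
  have hadd := hW.add_lt
  have htop := decode_fst_le h.cell.top_lt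
  have hcost (o : Option ℕ) := cellCost_le (I := I) (k := k) (b := b) (t := t) (o := o)
  have hcandidate := hcost (some ((decode m b).1 + j))
  have hbest := h.best.trans_le (hcost _)
  have hk := h.cell.row_lt
  have hfits : I.cellCost k b t (some ((decode m b).1 + j)) < W ∧ s.ivar Reg.best < W ∧
      (decode m b).1 < W ∧ j < W ∧ 1 < W ∧ (decode m b).1 + j < W ∧
      (decode m b).1 + j + 1 < W := by omega
  refine h.cell.evaluateSplit hW hinner hj ?_
  have evaluated := (h.setI (v := Reg.middle) (x := encode m ((decode m b).1 + j, I.sortedColor k))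
    (by simp)).setI (v := Reg.candidate) (x := I.cellCost k b t (some ((decode m b).1 + j)))
    (by simp)
  refine ⟨by simp [hfits], fun hlt => ?_, fun hle => ?_⟩
  · have post := (evaluated.replace hj (by simpa using hlt)).setI (v := Reg.inner) (x := j + 1)
      (by simp)
    simpa [h.cell.bottomGap, hinner, hfits] using post
  · exact ⟨by simpa using hinner, (evaluated.succ (by simpa using hle)).setI (by simp)⟩

theorem IsWordBound.tableIndex_lt (hW : IsWordBound n m W) (hk : k ≤ n)
    (hb : b < numCodes n m) (ht : t < numCodes n m) : tableIndex (numCodes n m) k b t < W := by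
  have hlt := Backbone.tableIndex_lt (Nat.lt_add_one_of_le hk) hb ht
  unfold IsWordBound at hW
  omega

theorem CellInv.value (h : CellInv I k b t s) :
    s.imem Arr.value (s.ivar Reg.outer) = I.cellCost k b t none := by
  rw [h.outer]
  exact h.table.value k b h.bottom_lt t h.top_lt (tableIndex_lt_add h.bottom_lt h.top_lt)

theorem CellInv.copy (hW : IsWordBound n m W) (h : CellInv I k b t s) {Q : State → Prop}
    (hQ : Q ((s.setI Reg.best (I.cellCost k b t none)).setI Reg.decision 0)) :
    Prog.copy.wp W Q s := by
  have hadd := hW.add_lt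
  have hindex := hW.tableIndex_lt h.row_lt.le h.bottom_lt h.top_lt
  have hcost := cellCost_le (I := I) (k := k) (b := b) (t := t) (o := none)
  have hk := h.row_lt
  have hvalue : I.cellCost k b t none < W := by omega
  rw [← h.outer] at hindex
  rw [← h.value] at hvalue hQ
  exact ⟨⟨hindex, hvalue⟩, by simpa using hadd.pos, by simpa using hQ⟩

theorem CellInv.runs_copy (hW : IsWordBound n m W) (h : CellInv I k b t s)
    (hrange : ¬ ((decode m b).1 ≤ I.sortedRank k ∧ I.sortedRank k < (decode m t).1)) {B : ℕ} :
    Runs W .copy s B (CellResult I k b t) :=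
  .of_wp <| h.copy hW
    { cell := (h.setI (by simp)).setI (by simp)
      best := by simpa [decisionCost] using (minBackbones_succ_of_not hrange).symm
      decision_le := by simp
      isOptimalDecision := fun h₁ h₂ => (hrange ⟨h₁, h₂⟩).elim }

theorem SearchInv.cost_le (h : SearchInv I k b t ((decode m t).1 + 1 - (decode m b).1) s) {g : ℕ}
    (hg : IsAllowed (I.sortedColor k) (decode m b) (decode m t) (some g)) :
    s.ivar Reg.best ≤ I.cellCost k b t (some g) := by
  obtain ⟨hbottom, htop⟩ := hg
  exact h.best_le g hbottom (by omega)

theorem SearchInv.cellResult (h : SearchInv I k b t ((decode m t).1 + 1 - (decode m b).1) s)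
    (hrange : (decode m b).1 ≤ I.sortedRank k ∧ I.sortedRank k < (decode m t).1)
    (hnone : IsAllowed (I.sortedColor k) (decode m b) (decode m t) none →
      s.ivar Reg.best ≤ I.cellCost k b t none) : CellResult I k b t s := by
  have hopt : IsOptimalDecision I.sortedRank I.sortedColor k (decode m b) (decode m t)
      (decodeDecision (s.ivar Reg.decision)) :=
    isOptimalDecision_of_forall_le hrange h.isAllowed fun o ho => by
      rw [← ColoredPoints.cellCost, ← h.best]
      rcases o with _ | g
      · exact hnone ho
      · exact h.cost_le ho
  exact ⟨h.cell, h.best.trans hopt.cost_eq.symm, h.decision_le, fun _ _ => hopt⟩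

theorem SearchInv.connect (h : SearchInv I k b t j s)
    (hnone : IsAllowed (I.sortedColor k) (decode m b) (decode m t) none)
    (hlt : I.cellCost k b t none < s.ivar Reg.best) :
    SearchInv I k b t j ((s.setI Reg.best (I.cellCost k b t none)).setI Reg.decision 0) where
  cell := (h.cell.setI (by simp)).setI (by simp)
  decision_le := by simp
  isAllowed := by simpa [decodeDecision] using hnone
  best := by simp [decodeDecision]
  best_le g hg hg' := by simpa using hlt.le.trans (h.best_le g hg hg')

theorem SearchInv.tryConnect (hW : IsWordBound n m W)
    (hrange : (decode m b).1 ≤ I.sortedRank k ∧ I.sortedRank k < (decode m t).1)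
    (h : SearchInv I k b t ((decode m t).1 + 1 - (decode m b).1) s) :
    Prog.tryConnect.wp W (CellResult I k b t) s := by
  have hadd := hW.add_lt
  have hk := h.cell.row_lt
  have hcolor := ColoredPoints.sortedColor_lt (I := I) hk
  have hcost (o : Option ℕ) := cellCost_le (I := I) (k := k) (b := b) (t := t) (o := o)
  have hbest := h.best.trans_le (hcost _)
  have hnone := hcost none
  have hfits : s.ivar Reg.outer < W ∧ I.cellCost k b t none < W ∧ s.ivar Reg.best < W ∧
      I.sortedColor k < W ∧ m + 1 < W ∧ b < W ∧ t < W := by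
    refine ⟨h.cell.outer.trans_lt (hW.tableIndex_lt hk.le h.cell.bottom_lt h.cell.top_lt), ?_, ?_,
      ?_, ?_, h.cell.bottom_lt.trans hW.numCodes_lt, h.cell.top_lt.trans hW.numCodes_lt⟩ <;> omega
  refine ⟨by simp [h.cell.value, h.cell.color, h.cell.bottom, h.cell.top,
    h.cell.table.sorted.input.radix, hfits], fun hholds => ?_, fun hholds => ?_⟩
  all_goals
    simp only [Test.Holds, IExp.eval, h.cell.color, h.cell.bottom, h.cell.top,
      h.cell.table.sorted.input.radix, h.cell.value] at hholds
  · exact h.cell.copy hW ((h.connect hholds.1 hholds.2).cellResult hrange fun _ => by simp)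
  · exact h.cellResult hrange fun ho => not_lt.1 fun hlt => hholds ⟨ho, hlt⟩

theorem CellInv.runs_search (hW : IsWordBound n m W) (h : CellInv I k b t s)
    (hrange : (decode m b).1 ≤ I.sortedRank k ∧ I.sortedRank k < (decode m t).1) :
    Runs W .search s (n + 1) (CellResult I k b t) := by
  have hadd := hW.add_lt
  have htop := decode_fst_le h.top_lt
  have hfits : (decode m t).1 < W ∧ 1 < W ∧ (decode m t).1 + 1 < W ∧ (decode m b).1 < W := by omega
  refine .seq (.of_wp (h.initSearch hW (hrange.1.trans hrange.2.le))) fun s h =>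
    .seq (R := SearchInv I k b t ((decode m t).1 + 1 - (decode m b).1)) ?_
    fun s h => .of_wp (h.tryConnect hW hrange)
  refine (Runs.forLoop (SearchInv I k b t) (B := 0) (by omega) h (fun j s h => ?_)
    fun j hj s h hs => .of_wp (h.improve hW hs (by omega))).mono (by omega)
  simp [h.cell.topGap, h.cell.bottomGap, hfits]

theorem CellInv.runs_cell (hW : IsWordBound n m W) (h : CellInv I k b t s) :
    Runs W .cell s (n + 1) (CellResult I k b t) := by
  have hadd := hW.add_lt
  have hrank := ColoredPoints.sortedRank_lt (I := I) h.row_lt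
  have hbottom := decode_fst_le h.bottom_lt
  have htop := decode_fst_le h.top_lt
  refine .ite ?_ (fun hrange => h.runs_search hW ?_) fun hrange => h.runs_copy hW ?_
  · simp [h.rank, h.bottomGap, h.topGap]
    omega
  all_goals simpa [h.rank, h.bottomGap, h.topGap] using hrange

theorem TableInv.decodeCell (hW : IsWordBound n m W) (hk : k < n) (hb : b < numCodes n m)
    (ht : t < numCodes n m) (h : TableInv I (tableIndex (numCodes n m) k b t) s)
    (houter : s.ivar Reg.outer = tableIndex (numCodes n m) k b t) :
    Prog.decodeCell.wp W (CellInv I k b t) s := by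
  have hadd := hW.add_lt
  have hN : 0 < numCodes n m := numCodes_pos
  have hindex := hW.tableIndex_lt hk.le hb ht
  have hcodes := hW.numCodes_lt
  have hrank := ColoredPoints.sortedRank_lt (I := I) hk
  have hcolor := ColoredPoints.sortedColor_lt (I := I) hk
  have hfits : k < W ∧ b < W ∧ t < W ∧ m + 1 < W ∧ I.sortedRank k < W ∧ I.sortedColor k < W := by
    omega
  have post : CellInv I k b t (((((((s.setI Reg.row k).setI Reg.bottom b).setI Reg.top t).setI
      Reg.rank (I.sortedRank k)).setI Reg.color (I.sortedColor k)).setI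
      Reg.bottomGap (decode m b).1).setI Reg.topGap (decode m t).1) := by
    refine ⟨hk, hb, ht, h.congr h.sorted.input.congr, by simpa, ?_, ?_, ?_, ?_, ?_, ?_, ?_⟩ <;> simp
  simpa [Prog.decodeCell, houter, h.sorted.input.numCodes, h.sorted.input.radix, hindex, hcodes,
    hN.ne', tableIndex_mod ht, tableIndex_div_mod hb ht, tableIndex_div_div hb ht, hfits,
    h.sorted.sortedRank k hk, h.sorted.sortedColor k hk, decode] using post

theorem HoldsDecisions.update {a : ℕ → ℕ} (hk : k < n) (hb : b < numCodes n m)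
    (ht : t < numCodes n m) (ha : HoldsDecisions I (tableIndex (numCodes n m) k b t) a)
    (hx : x ≤ n + 1) (hopt : (decode m b).1 ≤ I.sortedRank k → I.sortedRank k < (decode m t).1 →
      IsOptimalDecision I.sortedRank I.sortedColor k (decode m b) (decode m t) (decodeDecision x)) :
    HoldsDecisions I (tableIndex (numCodes n m) k b t + 1)
      (Function.update a (tableIndex (numCodes n m) k b t) x) := by
  intro k' b' hb' t' ht' hlt hbottom htop
  rcases Nat.lt_succ_iff_lt_or_eq.1 hlt with hlt | heq
  · rw [Function.update_of_ne hlt.ne]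
    exact ha k' b' hb' t' ht' hlt hbottom htop
  · obtain ⟨rfl, rfl, rfl⟩ := tableIndex_inj hb' hb ht' ht heq
    rw [Function.update_self]
    exact ⟨hx, hopt hbottom htop⟩

theorem CellResult.store (hW : IsWordBound n m W) (h : CellResult I k b t s) :
    Prog.store.wp W (fun s => s.ivar Reg.outer = tableIndex (numCodes n m) k b t ∧
      TableInv I (tableIndex (numCodes n m) k b t + 1)
        (s.setI Reg.outer (tableIndex (numCodes n m) k b t + 1))) s := by
  have hadd := hW.add_lt
  obtain ⟨cell, hbest, hdecision, hopt⟩ := h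
  obtain ⟨hk, hb, ht⟩ := And.intro cell.row_lt (And.intro cell.bottom_lt cell.top_lt)
  have hindex := hW.tableIndex_lt hk hb ht
  rw [tableIndex_succ] at hindex
  have hvalue := minBackbones_le (r := I.sortedRank) (c := I.sortedColor) (k := k + 1)
    (b := decode m b) (t := decode m t)
  have hcodes := hW.numCodes_lt
  have hfits : tableIndex (numCodes n m) k b t < W ∧ s.ivar Reg.best < W ∧
      s.ivar Reg.decision < W ∧ numCodes n m * numCodes n m < W := by omega
  have post : TableInv I (tableIndex (numCodes n m) k b t + 1)
      (((s.writeI Arr.value (tableIndex (numCodes n m) k b t + numCodes n m * numCodes n m)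
        (s.ivar Reg.best)).writeI Arr.decision (tableIndex (numCodes n m) k b t)
        (s.ivar Reg.decision)).setI Reg.outer (tableIndex (numCodes n m) k b t + 1)) :=
    { sorted := cell.table.sorted.congr cell.table.sorted.input.congr
      decision := by
        simpa using HoldsDecisions.update hk hb ht cell.table.decision hdecision hopt
      value := by
        intro k' b' hb' t' ht' hlt
        rw [Nat.add_right_comm, Nat.lt_succ_iff_lt_or_eq] at hlt
        rcases hlt with hlt | heq
        · simpa [hlt.ne] using cell.table.value k' b' hb' t' ht' hlt
        · rw [← tableIndex_succ] at heq
          obtain ⟨rfl, rfl, rfl⟩ := tableIndex_inj hb' hb ht' ht heq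
          simpa [tableIndex_succ] using hbest }
  simpa [Prog.store, cell.outer, cell.table.sorted.input.numCodes, hfits, hcodes, hindex] using post

end Cell

theorem SortInv.tableInv (h : SortInv I n s) : TableInv I 0 s where
  sorted := h.holdsSorted
  value k b _ t _ hlt := by
    obtain rfl : k = 0 := by
      by_contra hk
      obtain ⟨k, rfl⟩ := Nat.exists_eq_succ_of_ne_zero hk
      rw [tableIndex_succ] at hlt
      omega
    simp [h.value, minBackbones]
  decision _ _ _ _ _ hlt := (Nat.not_lt_zero _ hlt).elim

theorem runs_table (hW : IsWordBound n m W) (h : SortInv I n s) :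
    Runs W .table s (n * numCodes n m * numCodes n m * (n + 2))
      (TableInv I (n * numCodes n m * numCodes n m)) := by
  have hadd := hW.add_lt
  have hN := hW.numCodes_lt
  have hrows : n * numCodes n m ≤ n * numCodes n m * numCodes n m :=
    Nat.le_mul_of_pos_right _ numCodes_pos
  have hentries : n * numCodes n m * numCodes n m < W := by
    unfold IsWordBound at hW
    nlinarith
  refine .forLoop (TableInv I) hentries (h.tableInv.congr h.input.congr) (fun j s h => ?_)
    fun e he s h hs => ?_
  · simp [h.sorted.input.size, h.sorted.input.numCodes, hN, hentries, hrows.trans_lt hentries]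
    omega
  · obtain ⟨k, hk, b, hb, t, ht, rfl⟩ := exists_eq_tableIndex numCodes_pos he
    exact .seq (.of_wp (h.decodeCell hW hk hb ht hs)) fun s h =>
      .seq (h.runs_cell hW) fun s h => .of_wp (h.store hW)

end Table

/-! ### Placing the labels -/

section Placement

variable {n m W : ℕ} {I : ColoredPoints n m} {s s' : State}

/-- The height of a new label with `g` points below it between two heights `a` and `b`: the middle
of the available interval. -/
noncomputable def ColoredPoints.newHeight (I : ColoredPoints n m) (a b : ℝ) (g : ℕ) : ℝ :=
  (max (I.level g) a + min (I.level (g + 1)) b) / 2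

namespace Sweep

variable {w : Sweep} {j k g : ℕ} {b t : ℝ × ℕ}

/-- The first `j` labels. -/
def take (w : Sweep) (j : ℕ) : Sweep := { w with numLabels := j }

theorem backbones_take_succ :
    (w.take (j + 1)).backbones I = insert (w.label j) ((w.take j).backbones I) := by
  simp only [backbones, take, Finset.range_add_one, Finset.image_insert]
  rw [Finset.insert_comm I.top, Finset.insert_comm I.bottom]

theorem adjacent_bottom_top (hn : 0 < n) : Adjacent ((w.take 0).backbones I) I.bottom I.top := by
  refine ⟨by simp [backbones], by simp [backbones], ColoredPoints.ymin_lt_ymax (I := I) hn, ?_⟩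
  simp [backbones, take]

theorem IsValid.snd_le (hw : w.IsValid I k) {c : ℝ × ℕ} (hc : c ∈ w.backbones I) : c.2 ≤ m := by
  rcases mem_backbones.1 hc with rfl | rfl | ⟨l, hl, rfl⟩
  · exact le_rfl
  · exact le_rfl
  · exact (hw.color_lt l hl).le

theorem IsValid.newHeight_mem (hn : 0 < n) (hw : w.IsValid I k)
    (h : Adjacent (w.backbones I) b t) (hb : I.gap b.1 ≤ g) (ht : g ≤ I.gap t.1) :
    I.newHeight b.1 t.1 g ∈ Set.Ioo b.1 t.1 ∧
      I.newHeight b.1 t.1 g ∈ Set.Ioo (I.level g) (I.level (g + 1)) := by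
  have hgn : g ≤ n := ht.trans ColoredPoints.gap_le
  have hmin := (hw.fst_mem_Icc hn h.left_mem).1.trans_lt h.lt
  have hmax := h.lt.trans_le (hw.fst_mem_Icc hn h.right_mem).2
  have hlt : max (I.level g) b.1 < min (I.level (g + 1)) t.1 := by
    refine max_lt (lt_min ?_ ?_) (lt_min ?_ h.lt)
    · exact ColoredPoints.level_strictMonoOn hn (show g ≤ n + 1 by omega)
        (show g + 1 ≤ n + 1 by omega) g.lt_succ_self
    · exact ColoredPoints.level_lt_of_le_gap ht hmin (hw.fst_ne_sortedY h.right_mem)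
    · exact ColoredPoints.lt_level_succ_of_gap_le hb hgn hmax
  have hlower := left_lt_add_div_two.2 hlt
  have hupper := add_div_two_lt_right.2 hlt
  exact ⟨⟨(le_max_right _ _).trans_lt hlower, hupper.trans_le (min_le_right _ _)⟩,
    ⟨(le_max_left _ _).trans_lt hlower, hupper.trans_le (min_le_left _ _)⟩⟩

end Sweep

namespace Prog

/-- Replace real variable `v` by its maximum with `e`. -/
def raise (v : ℕ) (e : RExp) : Prog := ite (.rlt (.var v) e) (rset v e) skip

/-- Replace real variable `v` by its minimum with `e`. -/
def lower (v : ℕ) (e : RExp) : Prog := ite (.rlt e (.var v)) (rset v e) skip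

@[simp]
theorem wp_raise {v : ℕ} {e : RExp} {Q : State → Prop} :
    (raise v e).wp W Q s ↔ e.Fits W s ∧ Q (s.setR v (max (s.rvar v) (e.eval s))) := by
  have hself : s.setR v (s.rvar v) = s := by simp [State.setR]
  rcases lt_or_ge (s.rvar v) (e.eval s) with h | h
  · simp +contextual [raise, h, h.le]
  · simp [raise, h, hself]

@[simp]
theorem wp_lower {v : ℕ} {e : RExp} {Q : State → Prop} :
    (lower v e).wp W Q s ↔ e.Fits W s ∧ Q (s.setR v (min (s.rvar v) (e.eval s))) := by
  have hself : s.setR v (s.rvar v) = s := by simp [State.setR]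
  rcases lt_or_ge (e.eval s) (s.rvar v) with h | h
  · simp +contextual [lower, h, h.le]
  · simp [lower, h, hself]

/-- Load the point to be handled in round `outer`, and start with the sides of the rectangle as its
neighboring backbones. -/
def loadPoint : Prog := block [
  iset Reg.row (.sub (.sub (.var Reg.size) (.const 1)) (.var Reg.outer)),
  iset Reg.point (.read Arr.order (.var Reg.row)),
  iset Reg.color (.read Arr.sortedColor (.var Reg.row)),
  rset Reg.pointY (.read Arr.y (.var Reg.point)),
  rset Reg.bottomY (.var Reg.ymin),
  rset Reg.topY (.var Reg.ymax),
  iset Reg.bottom (.var Reg.numColors),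
  iset Reg.top (.add (.mul (.var Reg.size) (.var Reg.radix)) (.var Reg.numColors))]

/-- Replace the neighboring backbone below the point by label `inner`. -/
def setBottom : Prog := block [
  rset Reg.bottomY (.read Arr.labelY (.var Reg.inner)),
  iset Reg.bottom (.read Arr.labelCode (.var Reg.inner)),
  iset Reg.bottomLabel (.var Reg.inner)]

/-- Replace the neighboring backbone above the point by label `inner`. -/
def setTop : Prog := block [
  rset Reg.topY (.read Arr.labelY (.var Reg.inner)),
  iset Reg.top (.read Arr.labelCode (.var Reg.inner)),
  iset Reg.topLabel (.var Reg.inner)]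

/-- Replace a neighboring backbone by label `inner` if the latter is closer to the point. -/
def scan : Prog :=
  ite (.rlt (.read Arr.labelY (.var Reg.inner)) (.var Reg.pointY))
    (ite (.rlt (.var Reg.bottomY) (.read Arr.labelY (.var Reg.inner))) setBottom skip)
    (ite (.rlt (.read Arr.labelY (.var Reg.inner)) (.var Reg.topY)) setTop skip)

/-- Connect the point to the neighboring backbone of its color. -/
def connect : Prog :=
  ite (.ieq (.var Reg.color) (.mod (.var Reg.top) (.var Reg.radix)))
    (iwrite Arr.assign (.var Reg.point) (.var Reg.topLabel))
    (iwrite Arr.assign (.var Reg.point) (.var Reg.bottomLabel))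

/-- Compute the height of a new label in the gap given by the decision. -/
def chooseHeight : Prog := block [
  iset Reg.decision (.sub (.var Reg.decision) (.const 1)),
  rset Reg.lowerBound (.read Arr.level (.var Reg.decision)),
  raise Reg.lowerBound (.var Reg.bottomY),
  rset Reg.upperBound (.read Arr.level (.add (.var Reg.decision) (.const 1))),
  lower Reg.upperBound (.var Reg.topY),
  rset Reg.labelY (.div (.add (.var Reg.lowerBound) (.var Reg.upperBound)) (.const 2))]

/-- Place a new label at height `labelY`, and connect the point to it. -/
def addLabel : Prog := block [
  rwrite Arr.labelY (.var Reg.numLabels) (.var Reg.labelY),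
  iwrite Arr.labelCode (.var Reg.numLabels)
    (.add (.mul (.var Reg.decision) (.var Reg.radix)) (.var Reg.color)),
  iwrite Arr.labelColor (.var Reg.numLabels) (.var Reg.color),
  iwrite Arr.assign (.var Reg.point) (.var Reg.numLabels),
  iset Reg.numLabels (.add (.var Reg.numLabels) (.const 1))]

/-- Follow the decision that is stored for the point and its neighboring backbones. -/
def decide : Prog := block [
  iset Reg.decision (.read Arr.decision (indexExp Reg.row Reg.bottom Reg.top)),
  ite (.ieq (.var Reg.decision) (.const 0)) connect (seq chooseHeight addLabel)]

/-- Handle the points from left to right. -/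
def sweep : Prog := block [
  iset Reg.numLabels (.const 0),
  forLoop Reg.outer (.var Reg.size) <| block [
    loadPoint, forLoop Reg.inner (.var Reg.numLabels) scan, decide]]

end Prog

/-- The sweep whose labels and assignment are stored in memory. -/
def State.sweep (s : State) : Sweep where
  numLabels := s.ivar Reg.numLabels
  label l := (s.rmem Arr.labelY l, s.imem Arr.labelColor l)
  assign := s.imem Arr.assign

@[simp]
theorem State.sweep_setI {v x : ℕ} (hv : v ≠ Reg.numLabels) : (s.setI v x).sweep = s.sweep := by
  simp [State.sweep, hv.symm]

@[simp]
theorem State.sweep_setR {v : ℕ} {x : ℝ} : (s.setR v x).sweep = s.sweep := rfl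

/-- The invariant of `Prog.sweep`: all points but the `k` rightmost ones are handled. -/
structure SweepInv (I : ColoredPoints n m) (k : ℕ) (s : State) : Prop where
  sorted : HoldsSorted I s
  decisions : HoldsDecisions I (n * numCodes n m * numCodes n m) (s.imem Arr.decision)
  isExtendable : s.sweep.IsExtendable I k
  numLabels_add_le : s.ivar Reg.numLabels + k ≤ n
  labelCode : ∀ l < s.ivar Reg.numLabels,
    s.imem Arr.labelCode l = encode m (I.gap (s.sweep.label l).1, (s.sweep.label l).2)

theorem SweepInv.congr {k : ℕ} (h : SweepInv I k s)
    (input : HoldsInput I s')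
    (himem : s'.imem = s.imem := by simp) (hrmem : s'.rmem = s.rmem := by simp)
    (hnumLabels : s'.ivar Reg.numLabels = s.ivar Reg.numLabels := by simp) : SweepInv I k s' := by
  have hsweep : s'.sweep = s.sweep := by simp only [State.sweep, himem, hrmem, hnumLabels]
  exact ⟨h.sorted.congr input (by rw [himem]) (by rw [himem]) (by rw [himem]) (by rw [hrmem]),
    himem ▸ h.decisions, hsweep ▸ h.isExtendable, hnumLabels ▸ h.numLabels_add_le,
    by rw [hsweep, himem, hnumLabels]; exact h.labelCode⟩

/-- The point with `k` points to its right is loaded, to be handled next. -/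
structure PointInv (I : ColoredPoints n m) (k : ℕ) (s : State) : Prop where
  row_lt : k < n
  sweep : SweepInv I (k + 1) s
  outer : s.ivar Reg.outer + (k + 1) = n
  row : s.ivar Reg.row = k
  point : s.ivar Reg.point = I.order k
  color : s.ivar Reg.color = I.sortedColor k
  pointY : s.rvar Reg.pointY = I.sortedY k

/-- Among the sides of the rectangle and the first `j` labels, `b` and `t` are the neighboring
backbones of the point with `k` points to its right. -/
structure ScanInv (I : ColoredPoints n m) (k : ℕ) (b t : ℝ × ℕ) (j : ℕ) (s : State) : Prop where
  point : PointInv I k s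
  adjacent : Adjacent ((s.sweep.take j).backbones I) b t
  sortedY_mem : I.sortedY k ∈ Set.Ioc b.1 t.1
  bottomY : s.rvar Reg.bottomY = b.1
  topY : s.rvar Reg.topY = t.1
  bottom : s.ivar Reg.bottom = encode m (I.gap b.1, b.2)
  top : s.ivar Reg.top = encode m (I.gap t.1, t.2)
  bottomLabel : b.2 = m ∨
    s.ivar Reg.bottomLabel < s.ivar Reg.numLabels ∧ s.sweep.label (s.ivar Reg.bottomLabel) = b
  topLabel : t.2 = m ∨
    s.ivar Reg.topLabel < s.ivar Reg.numLabels ∧ s.sweep.label (s.ivar Reg.topLabel) = t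

section Sweep

variable {k j g : ℕ} {b t : ℝ × ℕ}

theorem PointInv.congr (h : PointInv I k s)
    (hsweep : SweepInv I (k + 1) s')
    (houter : s'.ivar Reg.outer = s.ivar Reg.outer := by simp)
    (hrow : s'.ivar Reg.row = s.ivar Reg.row := by simp)
    (hpoint : s'.ivar Reg.point = s.ivar Reg.point := by simp)
    (hcolor : s'.ivar Reg.color = s.ivar Reg.color := by simp)
    (hpointY : s'.rvar Reg.pointY = s.rvar Reg.pointY := by simp) : PointInv I k s' :=
  ⟨h.row_lt, hsweep, houter ▸ h.outer, hrow ▸ h.row, hpoint ▸ h.point, hcolor ▸ h.color,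
    hpointY ▸ h.pointY⟩

theorem SweepInv.loadPoint (hW : IsWordBound n m W) (hk : k < n) (h : SweepInv I (k + 1) s)
    (houter : s.ivar Reg.outer + (k + 1) = n) :
    Prog.loadPoint.wp W (fun s => ScanInv I k I.bottom I.top 0 (s.setI Reg.inner 0)) s := by
  have hadd := hW.add_lt
  have hrow : n - 1 - s.ivar Reg.outer = k := by omega
  have horder := ColoredPoints.order_lt (I := I) hk
  have hcolor := ColoredPoints.sortedColor_lt (I := I) hk
  have htop : n * (m + 1) + m < numCodes n m := mul_add_lt_mul n.lt_succ_self m.lt_succ_self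
  have hcodes := hW.numCodes_lt
  have hfits : n < W ∧ m < W ∧ 1 < W ∧ s.ivar Reg.outer < W ∧ k < W ∧ I.order k < W ∧
      I.sortedColor k < W ∧ m + 1 < W ∧ n * (m + 1) < W ∧ n * (m + 1) + m < W := by omega
  have post : ScanInv I k I.bottom I.top 0 (((((((((s.setI Reg.row k).setI Reg.point
      (I.order k)).setI Reg.color (I.sortedColor k)).setR Reg.pointY (I.sortedY k)).setR
      Reg.bottomY I.ymin).setR Reg.topY I.ymax).setI Reg.bottom m).setI Reg.top
      (n * (m + 1) + m)).setI Reg.inner 0) :=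
    { point := ⟨hk, h.congr h.sorted.input.congr, by simpa, by simp, by simp, by simp, by simp⟩
      adjacent := Sweep.adjacent_bottom_top (by omega)
      sortedY_mem := Set.Ioo_subset_Ioc_self (ColoredPoints.sortedY_mem_Ioo hk)
      bottomY := by simp [ColoredPoints.bottom]
      topY := by simp [ColoredPoints.top]
      bottom := by simp [ColoredPoints.bottom, ColoredPoints.gap_eq_zero, encode]
      top := by simp [ColoredPoints.top, ColoredPoints.gap_eq_n, encode]
      bottomLabel := .inl rfl
      topLabel := .inl rfl }
  simpa [Prog.loadPoint, h.sorted.input.size, h.sorted.input.numColors, h.sorted.input.radix,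
    h.sorted.input.ymin, h.sorted.input.ymax, h.sorted.input.y, hrow, h.sorted.order k hk,
    h.sorted.sortedColor k hk, hfits, ← ColoredPoints.sortedY.eq_def] using post

theorem ScanInv.skip (h : ScanInv I k b t j s) (hc : (s.sweep.label j).1 ∉ Set.Ioo b.1 t.1) :
    ScanInv I k b t (j + 1) (s.setI Reg.inner (j + 1)) := by
  obtain ⟨hpoint, hadj, hY, hbottomY, htopY, hbottom, htop, hbottomLabel, htopLabel⟩ := h
  refine ⟨hpoint.congr (hpoint.sweep.congr hpoint.sweep.sorted.input.congr), ?_, hY, by simpa,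
    by simpa, by simpa, by simpa, by simpa, by simpa⟩
  rw [State.sweep_setI (by simp), Sweep.backbones_take_succ]
  exact hadj.insert_of_notMem_Ioo hc

theorem ScanInv.setBottom (h : ScanInv I k b t j s) (hj : j < s.ivar Reg.numLabels)
    (hb : b.1 < (s.sweep.label j).1) (hY : (s.sweep.label j).1 < I.sortedY k) :
    ScanInv I k (s.sweep.label j) t (j + 1) ((((s.setR Reg.bottomY (s.sweep.label j).1).setI
      Reg.bottom (s.imem Arr.labelCode j)).setI Reg.bottomLabel j).setI Reg.inner (j + 1)) where
  point := h.point.congr (h.point.sweep.congr h.point.sweep.sorted.input.congr)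
  adjacent := by
    rw [Sweep.backbones_take_succ]
    exact h.adjacent.insert_left ⟨hb, hY.trans_le h.sortedY_mem.2⟩
  sortedY_mem := ⟨hY, h.sortedY_mem.2⟩
  bottomY := by simp
  topY := by simpa using h.topY
  bottom := by simpa using h.point.sweep.labelCode j hj
  top := by simpa using h.top
  bottomLabel := .inr ⟨by simpa, by simp⟩
  topLabel := by simpa using h.topLabel

theorem ScanInv.setTop (h : ScanInv I k b t j s) (hj : j < s.ivar Reg.numLabels)
    (ht : (s.sweep.label j).1 < t.1) (hY : I.sortedY k ≤ (s.sweep.label j).1) :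
    ScanInv I k b (s.sweep.label j) (j + 1) ((((s.setR Reg.topY (s.sweep.label j).1).setI
      Reg.top (s.imem Arr.labelCode j)).setI Reg.topLabel j).setI Reg.inner (j + 1)) where
  point := h.point.congr (h.point.sweep.congr h.point.sweep.sorted.input.congr)
  adjacent := by
    rw [Sweep.backbones_take_succ]
    exact h.adjacent.insert_right ⟨h.sortedY_mem.1.trans_le hY, ht⟩
  sortedY_mem := ⟨h.sortedY_mem.1, hY⟩
  bottomY := by simpa using h.bottomY
  topY := by simp
  bottom := by simpa using h.bottom
  top := by simpa using h.point.sweep.labelCode j hj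
  bottomLabel := by simpa using h.bottomLabel
  topLabel := .inr ⟨by simpa, by simp⟩

theorem ScanInv.scan (hW : IsWordBound n m W) (h : ScanInv I k b t j s)
    (hj : j < s.ivar Reg.numLabels) (hinner : s.ivar Reg.inner = j) :
    Prog.scan.wp W (fun s' => s'.ivar Reg.inner = j ∧
      s'.ivar Reg.numLabels = s.ivar Reg.numLabels ∧
      ∃ b t, ScanInv I k b t (j + 1) (s'.setI Reg.inner (j + 1))) s := by
  have hadd := hW.add_lt
  have hlabels := h.point.sweep.numLabels_add_le
  have hcode : s.imem Arr.labelCode j < W := by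
    rw [h.point.sweep.labelCode j hj]
    exact (encode_lt ColoredPoints.gap_le
      (h.point.sweep.isExtendable.isValid.color_lt j hj).le).trans hW.numCodes_lt
  have hjW : j < W := by omega
  have bottomY := h.bottomY
  have topY := h.topY
  have pointY := h.point.pointY
  refine ⟨by simp [hinner, hjW], fun hbelow => ⟨by simp [hinner, hjW], fun hnear => ?_,
    fun hfar => ?_⟩, fun habove => ⟨by simp [hinner, hjW], fun hnear => ?_, fun hfar => ?_⟩⟩
  · simp only [Test.Holds, RExp.eval, IExp.eval, hinner, bottomY, pointY] at hbelow hnear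
    have post := h.setBottom hj hnear hbelow
    simpa [-Prod.exists, Prog.setBottom, hinner, hjW, hcode] using ⟨_, _, post⟩
  · simp only [Test.Holds, RExp.eval, IExp.eval, hinner, bottomY] at hfar
    exact ⟨hinner, rfl, b, t, h.skip fun hc => hfar hc.1⟩
  · simp only [Test.Holds, RExp.eval, IExp.eval, hinner, topY, pointY, not_lt] at habove hnear
    have post := h.setTop hj hnear habove
    simpa [-Prod.exists, Prog.setTop, hinner, hjW, hcode] using ⟨_, _, post⟩
  · simp only [Test.Holds, RExp.eval, IExp.eval, hinner, topY] at hfar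
    exact ⟨hinner, rfl, b, t, h.skip fun hc => hfar hc.2⟩

theorem ScanInv.runs_scan (hW : IsWordBound n m W)
    (h : ScanInv I k b t 0 (s.setI Reg.inner 0)) :
    Runs W (.forLoop Reg.inner (.var Reg.numLabels) Prog.scan) s (n + 1)
      fun s => ∃ b t, ScanInv I k b t (s.ivar Reg.numLabels) s := by
  have hadd := hW.add_lt
  have hle : s.ivar Reg.numLabels + (k + 1) ≤ n := h.point.sweep.numLabels_add_le
  have hlt : s.ivar Reg.numLabels < W := by omega
  have loop := Runs.forLoop (W := W) (B := 0) (v := Reg.inner) (e := .var Reg.numLabels)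
    (p := Prog.scan)
    (fun j s' => s'.ivar Reg.numLabels = s.ivar Reg.numLabels ∧ ∃ b t, ScanInv I k b t j s') hlt
    ⟨by simp, b, t, h⟩ (fun j s' h => ⟨by simpa [h.1] using hlt, h.1⟩) ?_
  · exact (loop.mono (by omega)).imp fun s' h => h.1.symm ▸ h.2
  rintro j hj s' ⟨hlabels, b, t, h⟩ hs'
  refine .of_wp ?_
  simpa [-Prod.exists, hlabels] using h.scan hW (hj.trans_eq hlabels.symm) hs'

theorem ScanInv.bottom_lt (h : ScanInv I k b t (s.ivar Reg.numLabels) s) :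
    s.ivar Reg.bottom < numCodes n m :=
  h.bottom.trans_lt <| encode_lt ColoredPoints.gap_le <|
    h.point.sweep.isExtendable.isValid.snd_le h.adjacent.left_mem

theorem ScanInv.top_lt (h : ScanInv I k b t (s.ivar Reg.numLabels) s) :
    s.ivar Reg.top < numCodes n m :=
  h.top.trans_lt <| encode_lt ColoredPoints.gap_le <|
    h.point.sweep.isExtendable.isValid.snd_le h.adjacent.right_mem

theorem ScanInv.isOptimalDecision (h : ScanInv I k b t (s.ivar Reg.numLabels) s) :
    s.imem Arr.decision (tableIndex (numCodes n m) k (s.ivar Reg.bottom) (s.ivar Reg.top)) ≤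
        n + 1 ∧
      IsOptimalDecision I.sortedRank I.sortedColor k (I.gap b.1, b.2) (I.gap t.1, t.2)
        (decodeDecision (s.imem Arr.decision
          (tableIndex (numCodes n m) k (s.ivar Reg.bottom) (s.ivar Reg.top)))) := by
  have hvalid := h.point.sweep.isExtendable.isValid
  have hstored := h.point.sweep.decisions k _ h.bottom_lt _ h.top_lt
    (tableIndex_lt h.point.row_lt h.bottom_lt h.top_lt)
  have hb : decode m (s.ivar Reg.bottom) = (I.gap b.1, b.2) :=
    h.bottom ▸ decode_encode (hvalid.snd_le h.adjacent.left_mem)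
  have ht : decode m (s.ivar Reg.top) = (I.gap t.1, t.2) :=
    h.top ▸ decode_encode (hvalid.snd_le h.adjacent.right_mem)
  rw [hb, ht] at hstored
  have hrange := (ColoredPoints.gap_le_and_lt_gap_iff h.point.row_lt _ _).2 h.sortedY_mem
  exact hstored hrange.1 hrange.2

theorem SweepInv.writeAssign {i l : ℕ} (h : SweepInv I (k + 1) s)
    (hext : (s.sweep.connect i l).IsExtendable I k) :
    SweepInv I k (s.writeI Arr.assign i l) where
  sorted := h.sorted.congr h.sorted.input.congr
  decisions := by simpa using h.decisions
  isExtendable := by simpa [State.sweep, Sweep.connect] using hext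
  numLabels_add_le := by
    have hle : s.ivar Reg.numLabels + (k + 1) ≤ n := h.numLabels_add_le
    exact (Nat.add_le_add_left k.le_succ _).trans hle
  labelCode := by simpa [State.sweep] using h.labelCode

theorem ScanInv.connect (hW : IsWordBound n m W)
    (h : ScanInv I k b t (s.ivar Reg.numLabels) s)
    (ho : IsOptimalDecision I.sortedRank I.sortedColor k (I.gap b.1, b.2) (I.gap t.1, t.2) none) :
    Prog.connect.wp W (fun s' => s'.ivar Reg.outer = s.ivar Reg.outer ∧ SweepInv I k s') s := by
  have hadd := hW.add_lt
  have hk := h.point.row_lt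
  have hlabels : s.ivar Reg.numLabels + (k + 1) ≤ n := h.point.sweep.numLabels_add_le
  have horder := ColoredPoints.order_lt (I := I) hk
  have hcolor := ColoredPoints.sortedColor_lt (I := I) hk
  have hfits : s.ivar Reg.top < W ∧ I.sortedColor k < W ∧ m + 1 < W ∧ I.order k < W := by
    refine ⟨h.top_lt.trans hW.numCodes_lt, ?_, ?_, ?_⟩ <;> omega
  have htop : s.ivar Reg.top % (m + 1) = t.2 :=
    congrArg Prod.snd <| h.top ▸
      decode_encode (h.point.sweep.isExtendable.isValid.snd_le h.adjacent.right_mem)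
  have attach {l : ℕ} (hl : l < s.ivar Reg.numLabels) (hlcolor : (s.sweep.label l).2 =
      I.sortedColor k) (hend : s.sweep.label l = b ∨ s.sweep.label l = t) :
      SweepInv I k (s.writeI Arr.assign (I.order k) l) :=
    h.point.sweep.writeAssign <| h.point.sweep.isExtendable.connect (by omega) hk h.adjacent
      h.sortedY_mem ho hl hlcolor hend
  refine ⟨by simp [h.point.color, h.point.sweep.sorted.input.radix, hfits], fun heq => ?_,
    fun hne => ?_⟩
  all_goals
    simp only [Test.Holds, IExp.eval, h.point.color, h.point.sweep.sorted.input.radix, htop] at *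
  · obtain ⟨hl, hlabel⟩ := h.topLabel.resolve_left (by omega)
    have post := attach hl (by rw [hlabel, heq]) (.inr hlabel)
    have hlW : s.ivar Reg.topLabel < W := by omega
    simpa [h.point.point, hfits, hlW] using post
  · have heq := ho.isAllowed.resolve_right hne
    obtain ⟨hl, hlabel⟩ := h.bottomLabel.resolve_left (by omega)
    have post := attach hl (by rw [hlabel, heq]) (.inl hlabel)
    have hlW : s.ivar Reg.bottomLabel < W := by omega
    simpa [h.point.point, hfits, hlW] using post

theorem SweepInv.addLabel {l : ℕ} {y : ℝ} (hW : IsWordBound n m W) (hk : k < n)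
    (h : SweepInv I (k + 1) s) (hl : s.ivar Reg.numLabels = l) (hy : s.rvar Reg.labelY = y)
    (hgap : s.ivar Reg.decision = I.gap y) (hcolor : s.ivar Reg.color = I.sortedColor k)
    (hpoint : s.ivar Reg.point = I.order k)
    (hext : ((s.sweep.addLabel (y, I.sortedColor k)).connect (I.order k) l).IsExtendable I k) :
    Prog.addLabel.wp W (fun s' => s'.ivar Reg.outer = s.ivar Reg.outer ∧ SweepInv I k s') s := by
  have hadd := hW.add_lt
  have hlabels : l + (k + 1) ≤ n := hl ▸ h.numLabels_add_le
  have hgn : I.gap y ≤ n := ColoredPoints.gap_le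
  have hcm := ColoredPoints.sortedColor_lt (I := I) hk
  have horder := ColoredPoints.order_lt (I := I) hk
  have hcode : I.gap y * (m + 1) + I.sortedColor k < W :=
    (encode_lt (b := (I.gap y, I.sortedColor k)) hgn hcm.le).trans hW.numCodes_lt
  have hfits : I.gap y < W ∧ I.gap y * (m + 1) < W ∧ I.sortedColor k < W ∧ m + 1 < W ∧
      I.order k < W ∧ l < W ∧ 1 < W ∧ l + 1 < W := by omega
  have hsweep : (((((s.writeR Arr.labelY l y).writeI Arr.labelCode l
      (I.gap y * (m + 1) + I.sortedColor k)).writeI Arr.labelColor l (I.sortedColor k)).writeI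
      Arr.assign (I.order k) l).setI Reg.numLabels (l + 1)).sweep =
      (s.sweep.addLabel (y, I.sortedColor k)).connect (I.order k) l := by
    subst hl
    ext1
    · simp [State.sweep, Sweep.addLabel, Sweep.connect]
    · funext i
      by_cases hi : i = s.ivar Reg.numLabels <;>
        simp_all [State.sweep, Sweep.addLabel, Sweep.connect]
    · simp [State.sweep, Sweep.addLabel, Sweep.connect]
  have post : SweepInv I k (((((s.writeR Arr.labelY l y).writeI Arr.labelCode l
      (I.gap y * (m + 1) + I.sortedColor k)).writeI Arr.labelColor l (I.sortedColor k)).writeI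
      Arr.assign (I.order k) l).setI Reg.numLabels (l + 1)) :=
    { sorted := h.sorted.congr h.sorted.input.congr
      decisions := by simpa using h.decisions
      isExtendable := hsweep ▸ hext
      numLabels_add_le := by simpa using (by omega : l + 1 + k ≤ n)
      labelCode := by
        intro j hj
        rcases Nat.lt_succ_iff_lt_or_eq.1 (show j < l + 1 by simpa using hj) with hj | rfl
        · simpa [State.sweep, hj.ne] using h.labelCode j (hl ▸ hj)
        · simp [State.sweep, encode] }
  simpa [Prog.addLabel, hl, hy, hgap, hcolor, hpoint, h.sorted.input.radix, hfits, hcode] using post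

theorem ScanInv.addLabel (hW : IsWordBound n m W)
    (h : ScanInv I k b t (s.ivar Reg.numLabels) s) (hdecision : s.ivar Reg.decision = g + 1)
    (ho : IsOptimalDecision I.sortedRank I.sortedColor k (I.gap b.1, b.2) (I.gap t.1, t.2)
      (some g)) :
    (Prog.seq Prog.chooseHeight Prog.addLabel).wp W
      (fun s' => s'.ivar Reg.outer = s.ivar Reg.outer ∧ SweepInv I k s') s := by
  have hadd := hW.add_lt
  have hk := h.point.row_lt
  have hn : 0 < n := by omega
  have hgn : g ≤ n := ho.isAllowed.2.trans ColoredPoints.gap_le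
  have hfits : g < W ∧ g + 1 < W ∧ 1 < W ∧ 2 < W := by omega
  have hy := h.point.sweep.isExtendable.isValid.newHeight_mem hn h.adjacent ho.isAllowed.1
    ho.isAllowed.2
  have hext := h.point.sweep.isExtendable.addLabel_connect hn hk h.adjacent h.sortedY_mem ho
    hy.1 hy.2
  have post := SweepInv.addLabel hW hk (s := (((((s.setI Reg.decision g).setR Reg.lowerBound
      (I.level g)).setR Reg.lowerBound (max (I.level g) b.1)).setR Reg.upperBound
      (I.level (g + 1))).setR Reg.upperBound (min (I.level (g + 1)) t.1)).setR Reg.labelY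
      (I.newHeight b.1 t.1 g))
    (h.point.sweep.congr h.point.sweep.sorted.input.congr) rfl rfl
    (by simpa using (ColoredPoints.gap_eq_of_mem_Ioo_level hn hgn hy.2).symm)
    (by simpa using h.point.color) (by simpa using h.point.point) hext
  simpa [Prog.chooseHeight, hdecision, h.topY, h.bottomY, hfits,
    h.point.sweep.sorted.level _ (hgn.trans n.le_succ), ColoredPoints.newHeight,
    h.point.sweep.sorted.level _ (Nat.succ_le_succ hgn)] using post

theorem ScanInv.setI_decision {x : ℕ} (h : ScanInv I k b t j s) :
    ScanInv I k b t j (s.setI Reg.decision x) where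
  point := h.point.congr (h.point.sweep.congr h.point.sweep.sorted.input.congr)
  adjacent := h.adjacent
  sortedY_mem := h.sortedY_mem
  bottomY := h.bottomY
  topY := h.topY
  bottom := h.bottom
  top := h.top
  bottomLabel := h.bottomLabel
  topLabel := h.topLabel

theorem ScanInv.decide (hW : IsWordBound n m W)
    (h : ScanInv I k b t (s.ivar Reg.numLabels) s) :
    Prog.decide.wp W (fun s' => s'.ivar Reg.outer = s.ivar Reg.outer ∧ SweepInv I k s') s := by
  have hadd := hW.add_lt
  obtain ⟨hx, ho⟩ := h.isOptimalDecision
  have hrow : s.ivar Reg.row ≤ n := h.point.row.trans_le h.point.row_lt.le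
  have hfits := indexExp_fits_eval hW h.point.sweep.sorted.input hrow h.bottom_lt h.top_lt
  have hindex := hfits.2
  rw [h.point.row] at hindex
  generalize hdecision : s.imem Arr.decision
    (tableIndex (numCodes n m) k (s.ivar Reg.bottom) (s.ivar Reg.top)) = x at hx ho
  have hxW : x < W ∧ 0 < W := by omega
  have post : (Prog.ite (.ieq (.var Reg.decision) (.const 0)) .connect
      (.seq .chooseHeight .addLabel)).wp W
      (fun s' => s'.ivar Reg.outer = s.ivar Reg.outer ∧ SweepInv I k s')
      (s.setI Reg.decision x) := by
    refine ⟨by simp [hxW], fun hzero => ?_, fun hpos => ?_⟩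
    · obtain rfl : x = 0 := by simpa using hzero
      exact h.setI_decision.connect hW ho
    · obtain ⟨g, rfl⟩ := Nat.exists_eq_succ_of_ne_zero (by simpa using hpos : x ≠ 0)
      exact h.setI_decision.addLabel hW (by simp) ho
  refine ⟨by simp [hfits.1, hindex, hdecision, hxW], ?_⟩
  simpa only [Prog.block, IExp.eval, hindex, hdecision] using post

theorem runs_sweep_of_pos (hW : IsWordBound n m W) (hn : 0 < n)
    (h : TableInv I (n * numCodes n m * numCodes n m) s) :
    Runs W .sweep s (n * (n + 2)) (SweepInv I 0) := by
  have hadd := hW.add_lt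
  have hinit : SweepInv I n (s.setI Reg.numLabels 0) :=
    { sorted := h.sorted.congr h.sorted.input.congr
      decisions := h.decision
      isExtendable := .of_numLabels_eq_zero hn (by simp [State.sweep])
      numLabels_add_le := by simp
      labelCode := by simp }
  suffices Runs W .sweep s (n * (n + 2)) (SweepInv I (n - n)) by simpa using this
  refine .seq (.of_wp ⟨by simp; omega, hinit⟩) fun s h => .forLoop (fun i => SweepInv I (n - i))
    (by omega : n < W) (by simpa using h.congr h.sorted.input.congr)
    (fun j s h => ⟨by simp [h.sorted.input.size]; omega, h.sorted.input.size⟩)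
    fun i hi s h hs => ?_
  obtain ⟨k, hk⟩ : ∃ k, i + (k + 1) = n := ⟨n - (i + 1), by omega⟩
  rw [show n - i = k + 1 by omega] at h
  rw [show n - (i + 1) = k by omega]
  refine .seq (.of_wp (h.loadPoint hW (by omega) (hs ▸ hk))) fun s h =>
    .seq (h.runs_scan hW) fun s ⟨b, t, h⟩ =>
      (Runs.of_wp (h.decide hW)).imp fun s' ⟨houter, h'⟩ =>
        ⟨houter.trans (by have := h.point.outer; omega), h'.congr h'.sorted.input.congr⟩

theorem runs_sweep (hW : IsWordBound n m W)
    (h : TableInv I (n * numCodes n m * numCodes n m) s) :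
    Runs W .sweep s (n * (n + 2))
      fun s => s.ivar Reg.numLabels < W ∧
        ∃ hw : s.sweep.IsValid I 0, I.IsOptimal hw.toLabeling := by
  have hadd := hW.add_lt
  rcases n.eq_zero_or_pos with rfl | hn
  · let Empty (s : State) : Prop := s.ivar Reg.numLabels = 0 ∧ s.ivar Reg.size = 0
    have hempty : Empty (s.setI Reg.numLabels 0) := by simp [Empty, h.sorted.input.size]
    have hrun : Runs W .sweep s (0 * (0 + 2)) Empty :=
      .seq (.of_wp ⟨by simp; omega, hempty⟩) fun s h => .forLoop (fun _ => Empty)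
        (by omega : 0 < W) (by simpa [Empty] using h)
        (fun _ s h => ⟨h.2.trans_lt (by omega), h.2⟩) fun j hj => absurd hj j.not_lt_zero
    refine hrun.imp fun s h => ?_
    have hw : s.sweep.IsValid I 0 := .of_numLabels_eq_zero h.1
    exact ⟨h.1.trans_lt (by omega), hw, hw.isCrossingFree_toLabeling,
      fun _ _ => h.1.trans_le (Nat.zero_le _)⟩
  · exact (runs_sweep_of_pos hW hn h).imp fun s h =>
      ⟨by have := h.numLabels_add_le; omega, _, h.isExtendable.isOptimal_toLabeling hn⟩

end Sweep

end Placement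

/-! ### The algorithm -/

section Algorithm

variable {n m W : ℕ} {I : ColoredPoints n m} {s : State}

/-- The program that computes an optimal labeling. -/
def Prog.label : Prog := .block [.init, .sort, .table, .sweep, .iset Reg.size (.var Reg.numLabels)]

theorem outputs_toLabeling (hw : s.sweep.IsValid I 0) :
    Outputs (s.setI Reg.size (s.ivar Reg.numLabels)) hw.toLabeling where
  numLabels := by simp [Sweep.IsValid.toLabeling, State.sweep]
  assign _ := rfl
  color _ := rfl
  y _ := rfl

theorem runs_label (hW : IsWordBound n m W) :
    Runs W .label (inputState I) (n * numCodes n m * numCodes n m * (n + 2))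
      fun s => ∃ L, Outputs s L ∧ I.IsOptimal L := by
  have hcodes : n ≤ n * numCodes n m * numCodes n m :=
    (Nat.le_mul_of_pos_right n numCodes_pos).trans (Nat.le_mul_of_pos_right _ numCodes_pos)
  refine .seq ((runs_init hW).mono (Nat.zero_le _)) fun s h =>
    .seq ((runs_sort hW h).mono ?_) fun s h => .seq (runs_table hW h) fun s h =>
      .seq ((runs_sweep hW h).mono ?_) fun s ⟨hlt, hw, hL⟩ =>
        .of_wp ⟨hlt, hw.toLabeling, outputs_toLabeling hw, hL⟩
  all_goals gcongr
  exact one_le_two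

theorem isWordBound_pow : IsWordBound n m ((n + m + 2) ^ 7) := by
  obtain ⟨M, hM⟩ : ∃ M, n + m + 2 = M := ⟨_, rfl⟩
  rw [hM]
  have hbase : n + 1 ≤ M := by omega
  have hcodes : numCodes n m ≤ M ^ 2 :=
    (Nat.mul_le_mul hbase (by omega : m + 1 ≤ M)).trans_eq (sq M).symm
  have hrest : 2 * n + m + 2 < 3 * M ^ 5 := by
    have := Nat.le_self_pow (n := 5) (by decide) M
    omega
  calc (n + 1) * numCodes n m * numCodes n m + 2 * n + m + 2
      = (n + 1) * numCodes n m * numCodes n m + (2 * n + m + 2) := by ring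
    _ < M * M ^ 2 * M ^ 2 + 3 * M ^ 5 := add_lt_add_of_le_of_lt (by gcongr) hrest
    _ = 2 ^ 2 * M ^ 5 := by ring
    _ ≤ M ^ 2 * M ^ 5 := by gcongr; omega
    _ = M ^ 7 := by ring

theorem mul_numCodes_le (hm : 0 < n → 0 < m) :
    n * numCodes n m * numCodes n m * (n + 2) ≤ 48 * (n ^ 4 * m ^ 2) := by
  rcases n.eq_zero_or_pos with rfl | hn
  · simp
  have hcodes : numCodes n m ≤ 2 * n * (2 * m) := by
    specialize hm hn
    unfold numCodes
    gcongr <;> omega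
  calc n * numCodes n m * numCodes n m * (n + 2)
      ≤ n * (2 * n * (2 * m)) * (2 * n * (2 * m)) * (3 * n) := by gcongr; omega
    _ = 48 * (n ^ 4 * m ^ 2) := by ring

theorem label_correct (I : ColoredPoints n m) :
    ∃ t s L, Exec ((n + m + 2) ^ 7) .label (inputState I) t s ∧
      t ≤ 48 * Prog.label.time * (n ^ 4 * m ^ 2 + 1) ∧ Outputs s L ∧ I.IsOptimal L := by
  obtain ⟨t, s, hexec, ht, L, hs, hL⟩ := runs_label (I := I) isWordBound_pow
  refine ⟨t, s, L, hexec, ht.trans ?_, hs, hL⟩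
  have hbound := mul_numCodes_le (n := n) (m := m) fun hn => (I.color ⟨0, hn⟩).pos
  rw [mul_comm 48, mul_assoc Prog.label.time]
  exact Nat.mul_le_mul_left _ (by omega)

end Algorithm

end Backbone

/-- One program computes, on words of `O(log (n + m))` bits, a crossing-free labeling with the
minimum number of finite backbones for every input with `n` points and `m` colors, in time
`O(n ^ 4 * m ^ 2)` (where `+ 1` matters for `n = 0` only). -/
theorem mainTheorem3 :
    ∃ (prog : Backbone.Prog) (K d : ℕ), ∀ (n m : ℕ) (I : Backbone.ColoredPoints n m),
      ∃ (t : ℕ) (s : Backbone.State) (L : Backbone.Labeling n m),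
        Backbone.Exec ((n + m + 2) ^ d) prog (Backbone.inputState I) t s ∧
        t ≤ K * (n ^ 4 * m ^ 2 + 1) ∧
        Backbone.Outputs s L ∧ I.IsOptimal L := by
  exact ⟨.label, 48 * Backbone.Prog.label.time, 7, fun _ _ => Backbone.label_correct⟩
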